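/- Let $(Q,\mathcal F_Q,P)$ be a standard Borel space with a nonatomic probability measure, let $d\ge 1$, and let $\mathcal H=L^2(Q,P;\mathbb R^d)$. Let $\mathcal P_2(\mathbb R^d)$ be the space of Borel probability measures on $\mathbb R^d$ with finite quadratic moment, with the $L^2$-Wasserstein distance and its Borel sets, and let $\iota:\mathcal H\to\mathcal P_2(\mathbb R^d)$, $\iota(X)=X_\sharp P$. A Gaussian measure on a Hilbert space is nondegenerate if every nonzero continuous linear functional has positive variance. A Borel set is Gaussian-null if all nondegenerate Gaussian measures vanish on it. A measure $\mu\in\mathcal P_2(\mathbb R^d)$ is regular if it vanishes on all d.c. hypersurfaces, i.e. the sets $\{x+(f(x)-g(x))v : x\in v^\perp\}$ with $v\ne0$ and $f,g:v^\perp\to\mathbb R$ convex and Lipschitz. A Borel probability measure $\mathtt M$ on $\mathcal P_2(\mathbb R^d)$ with $\int\int|x|^2\,d\mu(x)\,d\mathtt M(\mu)<\infty$ is super-G-regular if $\mathtt M(B)=0$ for every Borel $B\subset\mathcal P_2(\mathbb R^d)$ such that $\iota^{-1}(B)$ is Gaussian-null in $\mathcal H$, and $\mathtt M$ is concentrated on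 the regular measures. Let $(E_n)_{n\in\mathbb N}$ be a complete orthonormal system of $L^2(Q,P;\mathbb R)$. Let $\Sigma_n\in\mathbb R^{d\times d}$ be symmetric positive definite matrices, and let $\alpha_n,\beta_n$ be real numbers with $$0<\alpha_n^2\le \Sigma_n v\cdot v\le\beta_n^2\quad\text{for all } v\in\mathbb R^d,\ |v|=1,\qquad \sum_n\beta_n^2<\infty .$$ Let $\xi_n\sim N(0,\Sigma_n)$ be independent centered Gaussian random vectors in $\mathbb R^d$ on a probability space. Let $\mathfrak g$ be the law in $\mathcal H$ of $\boldsymbol\xi=\sum_n\xi_nE_n$, and put $\alpha(q_1,q_2)=\big(\sum_n\alpha_n^2(E_n(q_1)-E_n(q_2))^2\big)^{1/2}$. Assume that $$\int_{Q^2}\frac{1}{\alpha(q_1,q_2)^d}\,dP(q_1)\,dP(q_2)<\infty .$$ Then: 1. The series defining $\boldsymbol\xi$ converges almost surely in $\mathcal H$. 2. $\mathtt G=\iota_\sharp\mathfrak g$ is super-G-regular. 3. (Berman's condition) The expected squared $L^2$-norm of the Fourier transform $\hat\mu_X(u)=\int_Q e^{iu\cdot X(q)}\,dP(q)$ of $X_\sharp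 P$ is finite: $$\int_{\mathcal H}\int_{\mathbb R^d}|\hat\mu_X(u)|^2\,du\,d\mathfrak g(X)<\infty .$$ 4. For $\mathfrak g$-a.e. $X$ the measure $X_\sharp P$ is absolutely continuous with respect to Lebesgue measure, with a density in $L^2(\mathbb R^d)$. -/

import Mathlib

open MeasureTheory ProbabilityTheory
open scoped ENNReal NNReal

noncomputable section

namespace RandomMeasureLaw

/-! ### The Wasserstein space over a Hilbert space -/

/-- Borel probability measures on `H` with finite quadratic moment. -/
structure P2 (H : Type*) [NormedAddCommGroup H] [MeasurableSpace H] where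
  toMeasure : Measure H
  isProbabilityMeasure : IsProbabilityMeasure toMeasure
  moment_lt_top : ∫⁻ x, ‖x‖ₑ ^ 2 ∂toMeasure < ∞

/-- The squared quadratic moment `∫ |x|² dμ`. -/
def P2.momentSq {H : Type*} [NormedAddCommGroup H] [MeasurableSpace H] (μ : P2 H) : ℝ≥0∞ :=
  ∫⁻ x, ‖x‖ₑ ^ 2 ∂μ.toMeasure

/-- The set of couplings (transport plans) with marginals `μ` and `ν`. -/
def couplings {X : Type*} [MeasurableSpace X] (μ ν : Measure X) : Set (Measure (X × X)) :=
  {γ | γ.map Prod.fst = μ ∧ γ.map Prod.snd = ν}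

/-- The `L²`-Kantorovich-Wasserstein distance. -/
def w2 {H : Type*} [NormedAddCommGroup H] [MeasurableSpace H] (μ ν : P2 H) : ℝ≥0∞ :=
  (⨅ γ ∈ couplings μ.toMeasure ν.toMeasure, ∫⁻ z, edist z.1 z.2 ^ 2 ∂γ) ^ (1 / 2 : ℝ)

/-- The topology of the Wasserstein distance: a set is open iff it contains a ball around each of
its points. -/
instance P2.instTopologicalSpace {H : Type*} [NormedAddCommGroup H] [MeasurableSpace H] :
    TopologicalSpace (P2 H) where
  IsOpen U := ∀ μ ∈ U, ∃ ε : ℝ≥0∞, 0 < ε ∧ ∀ ν, w2 μ ν < ε → ν ∈ U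
  isOpen_univ := fun _ _ => ⟨1, one_pos, fun _ _ => trivial⟩
  isOpen_inter := by
    rintro U V hU hV μ ⟨hμU, hμV⟩
    obtain ⟨a, ha, hUa⟩ := hU μ hμU
    obtain ⟨b, hb, hVb⟩ := hV μ hμV
    exact ⟨min a b, lt_min ha hb, fun ν hν =>
      ⟨hUa ν (hν.trans_le (min_le_left _ _)), hVb ν (hν.trans_le (min_le_right _ _))⟩⟩
  isOpen_sUnion := by
    rintro 𝒰 h μ ⟨U, hU, hμ⟩
    obtain ⟨a, ha, hUa⟩ := h U hU μ hμ
    exact ⟨a, ha, fun ν hν => ⟨U, hU, hUa ν hν⟩⟩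

/-- The Borel `σ`-algebra of the Wasserstein space. -/
instance P2.instMeasurableSpace {H : Type*} [NormedAddCommGroup H] [MeasurableSpace H] :
    MeasurableSpace (P2 H) := borel _

instance P2.instBorelSpace {H : Type*} [NormedAddCommGroup H] [MeasurableSpace H] :
    BorelSpace (P2 H) := ⟨rfl⟩

/-! ### Regular measures and Gaussian-null sets -/

/-- `S = {x + (f x - g x) v : x ∈ v^⊥}` for some `v ≠ 0` and convex Lipschitz functions
`f, g : v^⊥ → ℝ`. -/
def IsDCHypersurface {H : Type*} [NormedAddCommGroup H] [InnerProductSpace ℝ H] (S : Set H) :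
    Prop :=
  ∃ (v : H) (f g : (ℝ ∙ v)ᗮ → ℝ), v ≠ 0 ∧
    ConvexOn ℝ Set.univ f ∧ (∃ K, LipschitzWith K f) ∧
    ConvexOn ℝ Set.univ g ∧ (∃ K, LipschitzWith K g) ∧
    S = Set.range fun x : (ℝ ∙ v)ᗮ => (x : H) + (f x - g x) • v

/-- Regular measures: those vanishing on all d.c. hypersurfaces. -/
def P2.IsRegular {H : Type*} [NormedAddCommGroup H] [InnerProductSpace ℝ H] [MeasurableSpace H]
    (μ : P2 H) : Prop :=
  ∀ S : Set H, IsDCHypersurface S → μ.toMeasure S = 0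

/-- Nondegenerate Gaussian measures: every nonzero continuous linear functional has a
(real Gaussian) law of positive variance. -/
def IsNondegenerateGaussian {E : Type*} [NormedAddCommGroup E] [NormedSpace ℝ E]
    [MeasurableSpace E] (g : Measure E) : Prop :=
  IsGaussian g ∧ ∀ L : StrongDual ℝ E, L ≠ 0 → 0 < Var[L; g]

/-- Gaussian-null Borel sets. -/
def IsGaussianNull {E : Type*} [NormedAddCommGroup E] [NormedSpace ℝ E]
    [MeasurableSpace E] (B : Set E) : Prop :=
  MeasurableSet B ∧ ∀ g : Measure E, IsNondegenerateGaussian g → g B = 0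

/-! ### Lagrangian maps and laws of random measures -/

section Lagrangian

variable {Q : Type*} [MeasurableSpace Q] {H : Type*} [NormedAddCommGroup H]

/-- The Hilbert space `L²(Q, P; H)` carries its Borel `σ`-algebra. -/
instance instMeasurableSpaceLp (P : Measure Q) : MeasurableSpace (Lp H 2 P) := borel _

instance instBorelSpaceLp (P : Measure Q) : BorelSpace (Lp H 2 P) := ⟨rfl⟩

/-- The law map `ι(X) = X_♯ P` from `L²(Q, P; H)` to the Wasserstein space. -/
def lawMap [MeasurableSpace H] [BorelSpace H] (P : Measure Q) [IsProbabilityMeasure P]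
    (X : Lp H 2 P) : P2 H where
  toMeasure := P.map X
  isProbabilityMeasure :=
    Measure.isProbabilityMeasure_map (Lp.stronglyMeasurable X).measurable.aemeasurable
  moment_lt_top := by
    rw [lintegral_map (by fun_prop) (Lp.stronglyMeasurable X).measurable]
    have h := lintegral_rpow_enorm_lt_top_of_eLpNorm_lt_top (p := 2) (by norm_num) (by norm_num)
      (Lp.memLp X).2
    simpa using h

/-- Random G-null sets: Borel sets `B` of the Wasserstein space such that `ι⁻¹(B)` is
Gaussian-null. -/
def IsRandomGNull [InnerProductSpace ℝ H] [MeasurableSpace H] [BorelSpace H]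
    (P : Measure Q) [IsProbabilityMeasure P] (B : Set (P2 H)) : Prop :=
  MeasurableSet B ∧ IsGaussianNull (lawMap P ⁻¹' B)

/-- Super-G-regular laws of random measures: Borel probability measures on the Wasserstein space
with finite quadratic moment that vanish on all random G-null sets and are concentrated on the
regular measures. -/
structure IsSuperGRegular [InnerProductSpace ℝ H] [MeasurableSpace H] [BorelSpace H]
    (P : Measure Q) [IsProbabilityMeasure P] (M : Measure (P2 H)) : Prop where
  isProbabilityMeasure : IsProbabilityMeasure M
  moment_lt_top : ∫⁻ μ, μ.momentSq ∂M < ∞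
  gRegular : ∀ B : Set (P2 H), IsRandomGNull P B → M B = 0
  concentrated : ∀ᵐ μ ∂M, μ.IsRegular

/-! ### Karhunen-Loève series -/

/-- For `v : H` and a scalar function `e ∈ L²(Q, P)`, the function `q ↦ e(q) v` in
`L²(Q, P; H)`. -/
def vecMul [InnerProductSpace ℝ H] {P : Measure Q} (v : H) (e : Lp ℝ 2 P) : Lp H 2 P :=
  (ContinuousLinearMap.toSpanSingleton ℝ v).compLp e

/-- The random vector `∑ₙ ξₙ(ω) Eₙ` of `L²(Q, P; H)`. -/
def klVector [InnerProductSpace ℝ H] {P : Measure Q} {Ω : Type*}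
    (ξ : ℕ → Ω → H) (e : ℕ → Lp ℝ 2 P) (ω : Ω) : Lp H 2 P :=
  ∑' n, vecMul (ξ n ω) (e n)

/-- `α(q₁, q₂) = (∑ₙ αₙ² (Eₙ(q₁) - Eₙ(q₂))²)^{1/2}`, with values in `[0, ∞]`. -/
def alphaKernel {P : Measure Q} (α : ℕ → ℝ) (e : ℕ → Lp ℝ 2 P) (q₁ q₂ : Q) : ℝ≥0∞ :=
  (∑' n, ENNReal.ofReal (α n ^ 2 * (e n q₁ - e n q₂) ^ 2)) ^ (1 / 2 : ℝ)

end Lagrangian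

end RandomMeasureLaw

end

open RandomMeasureLaw
open scoped Matrix

/-! ### Finite measures with square integrable Fourier transform -/

/-! The proof computes a mean Fourier energy. Expanding the square, `|μ̂_X(u)|²` is the integral
over `(q₁, q₂)` of `exp(i u·(X(q₁) - X(q₂)))`. For the random series the increment is `∑ (Eₙ(q₁) -
Eₙ(q₂)) ξₙ`, a centered Gaussian vector whose variance in direction `u` is at least `α(q₁, q₂)²
|u|²`. Its characteristic function is therefore at most `exp(-α² |u|² / 2)`, and integrating in `u`
gives `(2π)^(d/2) α^(-d)`, integrable by assumption: this is Berman's condition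
(`lintegral_lintegral_charFun_klVector_lt_top`).

Hence almost every `X_♯ P` has a square integrable characteristic function, so by Plancherel an `L²`
density (`exists_density_of_charFun_sq_integrable`). Absolute continuity implies regularity, because
d.c. hypersurfaces are Lebesgue-null. Vanishing on random G-null sets holds because the law of the
series is itself a nondegenerate Gaussian measure (`isNondegenerateGaussian_map_klVector`).

Since `X` is only an `L²` class, pointwise increments are handled on finite partial sums. The limit
is taken through the continuity of `X ↦ μ̂_X(u)`, which factors through the Wasserstein space. -/

/-- Two locally finite measures on a finite-dimensional space agree if they agree on smooth
compactly supported functions. -/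
theorem MeasureTheory.Measure.ext_of_integral_contDiff {E : Type*} [NormedAddCommGroup E]
    [NormedSpace ℝ E] [FiniteDimensional ℝ E] [MeasurableSpace E] [BorelSpace E]
    {μ ν : Measure E} [IsLocallyFiniteMeasure μ] [IsLocallyFiniteMeasure ν]
    (h : ∀ g : E → ℝ, ContDiff ℝ (⊤ : ℕ∞) g → HasCompactSupport g →
      ∫ x, g x ∂μ = ∫ x, g x ∂ν) : μ = ν := by
  refine Measure.ext_of_integral_eq_on_compactlySupported fun f => ?_
  refine eq_of_forall_dist_le fun ε hε => ?_
  have hK : IsCompact (tsupport f) := f.hasCompactSupport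
  -- A uniform error `ε / C` on the support costs at most `ε` under both measures together; the
  -- summand 1 keeps `C` positive.
  set C := μ.real (tsupport f) + ν.real (tsupport f) + 1
  have hC : 0 < C := by positivity
  have hfc : Continuous f := f.continuous
  obtain ⟨g, hg, hgf, hgs⟩ := hfc.exists_contDiff_approx (n := ⊤) (ε := fun _ => ε / C)
    continuous_const (fun _ => by positivity)
  have hgK : ∀ x ∉ tsupport f, g x = 0 := fun x hx => by
    by_contra h0
    exact hx (subset_closure (hgs h0))
  have hgc : HasCompactSupport g := HasCompactSupport.intro hK hgK
  have key : ∀ (κ : Measure E) [IsLocallyFiniteMeasure κ],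
      dist (∫ x, f x ∂κ) (∫ x, g x ∂κ) ≤ ε / C * κ.real (tsupport f) := by
    intro κ _
    rw [dist_eq_norm, ← integral_sub (hfc.integrable_of_hasCompactSupport hK)
      (hg.continuous.integrable_of_hasCompactSupport hgc),
      ← setIntegral_eq_integral_of_forall_compl_eq_zero (s := tsupport f)
        (fun x hx => by rw [hgK x hx, image_eq_zero_of_notMem_tsupport hx, sub_zero])]
    refine norm_setIntegral_le_of_norm_le_const hK.measure_lt_top fun x _ => ?_
    rw [← dist_eq_norm, dist_comm]
    exact (hgf x).le
  calc dist (∫ x, f x ∂μ) (∫ x, f x ∂ν)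
      ≤ dist (∫ x, f x ∂μ) (∫ x, g x ∂μ) + dist (∫ x, g x ∂μ) (∫ x, f x ∂ν) := dist_triangle _ _ _
    _ ≤ ε / C * μ.real (tsupport f) + ε / C * ν.real (tsupport f) := by
        refine add_le_add (key μ) ?_
        rw [h g hg hgc, dist_comm]
        exact key ν
    _ ≤ ε / C * C := by
        rw [← mul_add]
        gcongr
        simp [C]
    _ = ε := by field_simp

theorem MeasureTheory.LocallyIntegrable.isLocallyFiniteMeasure_withDensity_ofReal {X : Type*}
    [TopologicalSpace X] [MeasurableSpace X] [OpensMeasurableSpace X] {ν : Measure X} {r : X → ℝ}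
    (hr : LocallyIntegrable r ν) :
    IsLocallyFiniteMeasure (ν.withDensity fun x => ENNReal.ofReal (r x)) := by
  refine ⟨fun x => ?_⟩
  obtain ⟨U, hU, hUr⟩ := hr x
  obtain ⟨V, hVU, hVo, hxV⟩ := mem_nhds_iff.1 hU
  refine ⟨V, hVo.mem_nhds hxV, ?_⟩
  rw [withDensity_apply _ hVo.measurableSet]
  refine (lintegral_mono fun x => ?_).trans_lt (hUr.mono_set hVU).2
  exact Real.ofReal_le_enorm _

/-- A finite measure which acts on smooth compactly supported functions as a locally integrable
function `r` has density `r`. -/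
theorem MeasureTheory.Measure.eq_withDensity_of_integral_contDiff {E : Type*}
    [NormedAddCommGroup E] [NormedSpace ℝ E] [FiniteDimensional ℝ E] [MeasurableSpace E]
    [BorelSpace E] {μ ν : Measure E} [IsFiniteMeasure μ] [IsLocallyFiniteMeasure ν] {r : E → ℝ}
    (hr : LocallyIntegrable r ν)
    (h : ∀ g : E → ℝ, ContDiff ℝ (⊤ : ℕ∞) g → HasCompactSupport g →
      ∫ x, g x ∂μ = ∫ x, g x * r x ∂ν) :
    μ = ν.withDensity fun x => ENNReal.ofReal (r x) := by
  -- Splitting `r` into positive and negative parts turns the hypothesis into `μ + νm = νp`, an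
  -- identity between positive measures.
  set νp := ν.withDensity fun x => ENNReal.ofReal (r x)
  set νm := ν.withDensity fun x => ENNReal.ofReal (-r x)
  have hrm : LocallyIntegrable (fun x => - r x) ν := hr.neg
  have : IsLocallyFiniteMeasure νp := hr.isLocallyFiniteMeasure_withDensity_ofReal
  have : IsLocallyFiniteMeasure νm := hrm.isLocallyFiniteMeasure_withDensity_ofReal
  have key : ∀ (s : E → ℝ), LocallyIntegrable s ν → ∀ g : E → ℝ,
      ∫ x, g x ∂(ν.withDensity fun x => ENNReal.ofReal (s x)) = ∫ x, g x * max (s x) 0 ∂ν := by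
    intro s hs g
    rw [integral_withDensity_eq_integral_toReal_smul₀
      hs.aestronglyMeasurable.aemeasurable.ennreal_ofReal (by simp)]
    exact integral_congr_ae (by filter_upwards with x; simp [mul_comm, ENNReal.toReal_ofReal'])
  have : IsLocallyFiniteMeasure (μ + νm) := ⟨fun x => by
    obtain ⟨U, hU, hUf⟩ := νm.finiteAt_nhds x
    exact ⟨U, hU, ENNReal.add_lt_top.2 ⟨measure_lt_top μ U, hUf⟩⟩⟩
  have hsum : μ + νm = νp := by
    refine Measure.ext_of_integral_contDiff fun g hg hgc => ?_
    have hI : ∀ (κ : Measure E) [IsLocallyFiniteMeasure κ], Integrable g κ := fun κ _ =>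
      hg.continuous.integrable_of_hasCompactSupport hgc
    have hgr : Integrable (fun x => g x * r x) ν := by
      simpa using hr.integrable_smul_left_of_hasCompactSupport hg.continuous hgc
    have hgm : Integrable (fun x => g x * max (-r x) 0) ν := by
      have : LocallyIntegrable (fun x => max (-r x) 0) ν := by
        refine hr.mono (hrm.aestronglyMeasurable.sup aestronglyMeasurable_const) ?_
        filter_upwards with x
        rcases le_total (-r x) 0 with h0 | h0
        · simp [h0]
        · simp [h0]
      simpa using this.integrable_smul_left_of_hasCompactSupport hg.continuous hgc
    rw [integral_add_measure (hI μ) (hI νm), key _ hrm, key _ hr, h g hg hgc,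
      ← integral_add hgr hgm]
    refine integral_congr_ae ?_
    filter_upwards with x
    rcases le_total (r x) 0 with h0 | h0
    · simp [h0]
    · simp [h0]
  -- On `{r < 0}` the measure `νp` vanishes, hence so does the smaller `νm`; but `νm` lives only
  -- there.
  have hνm : νm = 0 := by
    have hmeas : NullMeasurableSet {x | r x < 0} ν :=
      nullMeasurableSet_lt hr.aestronglyMeasurable.aemeasurable aemeasurable_const
    have h1 : νp {x | r x < 0} = 0 := by
      rw [withDensity_apply₀ _ hmeas, lintegral_eq_zero_iff' (by
        exact hr.aestronglyMeasurable.aemeasurable.ennreal_ofReal.restrict)]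
      filter_upwards [ae_restrict_mem₀ hmeas] with x hx
      simp [le_of_lt hx]
    have h2 : νm {x | r x < 0} = 0 := by
      refine le_antisymm ?_ bot_le
      rw [← h1, ← hsum]
      simp
    rw [withDensity_apply₀ _ hmeas, lintegral_eq_zero_iff' (by
        exact hrm.aestronglyMeasurable.aemeasurable.ennreal_ofReal.restrict),
      Filter.EventuallyEq, ae_restrict_iff'₀ hmeas] at h2
    refine withDensity_eq_zero_iff hrm.aestronglyMeasurable.aemeasurable.ennreal_ofReal |>.2 ?_
    filter_upwards [h2] with x hx
    by_cases h0 : r x < 0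
    · exact hx h0
    · simpa using h0
  rw [← hsum, hνm, add_zero]

/-- The Fourier transform of a finite measure, as a tempered distribution, is given by its
characteristic function. -/
theorem integral_fourier_eq_integral_mul_charFun {E : Type*} [NormedAddCommGroup E]
    [InnerProductSpace ℝ E] [FiniteDimensional ℝ E] [MeasurableSpace E] [BorelSpace E]
    (μ : Measure E) [IsFiniteMeasure μ] {g : E → ℂ} (hg : Integrable g) :
    ∫ x, FourierTransform.fourier g x ∂μ =
      ∫ ξ, g ξ * charFun μ ((-(2 * Real.pi)) • ξ) := by
  -- The Fourier kernel is `exp(-2πi⟨x, ξ⟩)` and that of `charFun` is `exp(i⟨x, u⟩)`, whence the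
  -- factor `-2π`. The kernel is unimodular, so Fubini applies.
  simp_rw [Real.fourier_eq', smul_eq_mul]
  rw [integral_integral_swap]
  · refine integral_congr_ae (by
      filter_upwards with ξ
      rw [charFun_apply, ← integral_const_mul]
      refine integral_congr_ae (by
        filter_upwards with x
        rw [mul_comm, real_inner_smul_right, real_inner_comm]
        congr 4
        ring))
  · have h1 : Integrable (fun z : E × E => g z.2) (μ.prod volume) := hg.comp_snd μ
    refine h1.mono ?_ ?_
    · refine AEStronglyMeasurable.mul ?_ h1.aestronglyMeasurable
      exact Continuous.aestronglyMeasurable (by fun_prop)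
    · filter_upwards with z
      simp only [Function.uncurry]
      rw [norm_mul, Complex.norm_exp_ofReal_mul_I, one_mul]

/-- A finite measure with square integrable characteristic function has a square integrable
density. -/
theorem exists_density_of_charFun_sq_integrable {E : Type*} [NormedAddCommGroup E]
    [InnerProductSpace ℝ E] [FiniteDimensional ℝ E] [MeasurableSpace E] [BorelSpace E]
    (μ : Measure E) [IsFiniteMeasure μ] (h : ∫⁻ u, ‖charFun μ u‖ₑ ^ 2 < ∞) :
    ∃ ρ : E → ℝ, (∀ x, 0 ≤ ρ x) ∧ MemLp ρ 2 volume ∧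
      μ = volume.withDensity fun x => ENNReal.ofReal (ρ x) := by
  have hF : MemLp (fun ξ : E => charFun μ ((-(2 * Real.pi)) • ξ)) 2 volume := by
    have h0 : MemLp (charFun μ) 2 volume := by
      refine ⟨measurable_charFun.aestronglyMeasurable, ?_⟩
      rw [eLpNorm_lt_top_iff_lintegral_rpow_enorm_lt_top (by norm_num) (by norm_num)]
      simpa using h
    have hc : (-(2 * Real.pi)) ≠ 0 := by simp [Real.pi_ne_zero]
    have h1 : MemLp (charFun μ) 2 (Measure.map (fun ξ : E => (-(2 * Real.pi)) • ξ) volume) := by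
      rw [Measure.map_addHaar_smul _ hc]
      exact h0.smul_measure (by simp)
    exact h1.comp_of_map (by fun_prop)
  set f : Lp ℂ 2 (volume : Measure E) := hF.toLp
  set ρ : Lp ℂ 2 (volume : Measure E) := FourierTransformInv.fourierInv f
  -- Each Schwartz `g` is the Fourier transform of its inverse transform, so pairing with `μ`
  -- becomes pairing with `f`, and duality moves the inverse transform onto `f`.
  have key : ∀ g : SchwartzMap E ℂ, ∫ x, g x ∂μ = ∫ x, g x * ρ x := by
    intro g
    have h1 := congrArg (fun T => T g) (Lp.fourierInv_toTemperedDistribution_eq f)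
    simp only [TemperedDistribution.fourierInv_apply, Lp.toTemperedDistribution_apply,
      smul_eq_mul] at h1
    rw [← h1]
    have h2 := integral_fourier_eq_integral_mul_charFun μ
      (FourierTransformInv.fourierInv g : SchwartzMap E ℂ).integrable
    rw [← SchwartzMap.fourier_coe, FourierTransform.fourier_fourierInv_eq] at h2
    rw [h2]
    refine integral_congr_ae ?_
    filter_upwards [hF.coeFn_toLp] with x hx
    rw [hx]
  have hr : MemLp (fun x => (ρ x).re) 2 volume := (Lp.memLp ρ).re
  have hμ := Measure.eq_withDensity_of_integral_contDiff (μ := μ)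
    (hr.locallyIntegrable one_le_two) (fun g hg hgc => by
      have hg₁ : HasCompactSupport (Complex.ofRealCLM ∘ g) := hgc.comp_left rfl
      have hg₂ : ContDiff ℝ (⊤ : ℕ∞) (Complex.ofRealCLM ∘ g) := by fun_prop
      have h1 := congrArg Complex.re (key (hg₁.toSchwartzMap hg₂))
      have hI : Integrable (fun x => (g x : ℂ) * ρ x) volume := by
        simpa using ((Lp.memLp ρ).locallyIntegrable one_le_two
          ).integrable_smul_left_of_hasCompactSupport hg.continuous hgc
      simp only [HasCompactSupport.toSchwartzMap_toFun, Function.comp,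
        Complex.ofRealCLM_apply] at h1
      rw [integral_complex_ofReal, Complex.ofReal_re] at h1
      rw [h1, ← RCLike.re_eq_complex_re, ← integral_re hI]
      simp)
  -- Real test functions see only the real part of `ρ`, and `ENNReal.ofReal` already truncates at 0,
  -- so taking the maximum leaves the measure unchanged.
  refine ⟨fun x => max (ρ x).re 0, fun x => le_max_right _ _, ?_, ?_⟩
  · refine hr.mono (hr.1.sup aestronglyMeasurable_const) ?_
    filter_upwards with x
    rcases le_total (ρ x).re 0 with h0 | h0
    · simp [h0]
    · simp [h0]
  · rw [hμ]
    congr 1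
    ext x
    rcases le_total (ρ x).re 0 with h0 | h0
    · simp [h0]
    · simp [h0]

/-! ### Nullity of d.c. hypersurfaces -/

/-- D.c. hypersurfaces are Lebesgue-null. -/
theorem RandomMeasureLaw.IsDCHypersurface.addHaar_eq_zero {E : Type*} [NormedAddCommGroup E]
    [InnerProductSpace ℝ E] [FiniteDimensional ℝ E] [MeasurableSpace E] [BorelSpace E]
    {S : Set E} (hS : IsDCHypersurface S) (μ : Measure E) [μ.IsAddHaarMeasure] : μ S = 0 := by
  obtain ⟨v, f, g, hv, -, ⟨K, hf⟩, -, ⟨L, hg⟩, rfl⟩ := hS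
  set h : (ℝ ∙ v)ᗮ → ℝ := fun x => f x - g x
  have hh : Continuous h := hf.continuous.sub hg.continuous
  have hvv : inner ℝ v v ≠ 0 := inner_self_ne_zero.2 hv
  have hperp : ∀ x : (ℝ ∙ v)ᗮ, inner ℝ v (x : E) = 0 := fun x =>
    Submodule.mem_orthogonal_singleton_iff_inner_right.1 x.2
  have hunique : ∀ (x y : (ℝ ∙ v)ᗮ) (a b : ℝ), (x : E) + a • v = y + b • v → x = y ∧ a = b := by
    intro x y a b hxy
    have hab : a = b := by
      have := congrArg (inner ℝ v) hxy
      simp only [inner_add_right, hperp, inner_smul_right, zero_add] at this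
      exact mul_right_cancel₀ hvv this
    subst hab
    exact ⟨Subtype.ext (add_right_cancel hxy), rfl⟩
  set φ : (ℝ ∙ v)ᗮ → E := fun x => (x : E) + h x • v
  -- An injective continuous image of a Polish space is Borel.
  have hφ : MeasurableSet (Set.range φ) := by
    refine (Continuous.measurableEmbedding (by fun_prop) fun x y hxy => ?_).measurableSet_range
    exact (hunique x y _ _ hxy).1
  -- A graph over `v^⊥` is disjoint from its shifts along `v`. The shifts by `v / (n + 1)` are
  -- infinitely many and bounded, so the graph must be null.
  refine Measure.addHaar_eq_zero_of_disjoint_translates μ (fun n : ℕ => (1 / ((n : ℝ) + 1)) • v)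
    ?_ ?_ hφ
  · refine (Metric.isBounded_closedBall (x := (0 : E)) (r := ‖v‖)).subset ?_
    rintro _ ⟨n, rfl⟩
    rw [mem_closedBall_zero_iff, norm_smul, Real.norm_of_nonneg (by positivity)]
    refine mul_le_of_le_one_left (norm_nonneg _) ?_
    rw [div_le_one (by positivity)]
    linarith [n.cast_nonneg (α := ℝ)]
  · intro m n hmn
    refine Set.disjoint_left.2 ?_
    rintro z hz₁ hz₂
    simp only [Set.singleton_add] at hz₁ hz₂
    obtain ⟨_, ⟨x, rfl⟩, rfl⟩ := hz₁
    obtain ⟨_, ⟨y, rfl⟩, hxy⟩ := hz₂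
    have h1 : (y : E) + (1 / ((n : ℝ) + 1) + h y) • v = x + (1 / ((m : ℝ) + 1) + h x) • v := by
      simp only [φ] at hxy
      rw [add_smul, add_smul, add_left_comm, hxy, add_left_comm]
    obtain ⟨rfl, h2⟩ := hunique _ _ _ _ h1
    refine hmn ?_
    have h3 : (1 : ℝ) / (n + 1) = 1 / (m + 1) := by linarith
    rw [one_div, one_div, inv_inj] at h3
    exact_mod_cast (add_right_cancel h3).symm

/-! ### Continuity of the law map and of characteristic functions -/

namespace RandomMeasureLaw

instance P2.instIsProbabilityMeasure {H : Type*} [NormedAddCommGroup H] [MeasurableSpace H]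
    (μ : P2 H) : IsProbabilityMeasure μ.toMeasure := μ.isProbabilityMeasure

section LawMap

variable {Q : Type*} [MeasurableSpace Q] {H : Type*} [NormedAddCommGroup H]

theorem lintegral_enorm_sq_coeFn_Lp {P : Measure Q} (X : Lp H 2 P) :
    ∫⁻ q, ‖X q‖ₑ ^ 2 ∂P = ‖X‖ₑ ^ 2 := by
  rw [Lp.enorm_def, eLpNorm_eq_lintegral_rpow_enorm_toReal (by norm_num) (by norm_num)]
  rw [← ENNReal.rpow_natCast, ← ENNReal.rpow_mul]
  simp

variable [MeasurableSpace H] [BorelSpace H] (P : Measure Q) [IsProbabilityMeasure P]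

theorem momentSq_lawMap (X : Lp H 2 P) : (lawMap P X).momentSq = ‖X‖ₑ ^ 2 := by
  rw [← lintegral_enorm_sq_coeFn_Lp]
  exact lintegral_map (by fun_prop) (Lp.stronglyMeasurable X).measurable

variable [SecondCountableTopology H]

/-- The joint law `(X, Y)_♯ P` is a coupling whose cost is `‖X - Y‖²`. -/
theorem w2_lawMap_le (X Y : Lp H 2 P) : w2 (lawMap P X) (lawMap P Y) ≤ edist X Y := by
  have hX : Measurable X := (Lp.stronglyMeasurable X).measurable
  have hY : Measurable Y := (Lp.stronglyMeasurable Y).measurable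
  have hγ : P.map (fun q => (X q, Y q)) ∈
      couplings (lawMap P X).toMeasure (lawMap P Y).toMeasure := by
    constructor
    · rw [Measure.map_map measurable_fst (hX.prodMk hY)]; rfl
    · rw [Measure.map_map measurable_snd (hX.prodMk hY)]; rfl
  have h1 : ⨅ γ ∈ couplings (lawMap P X).toMeasure (lawMap P Y).toMeasure,
      ∫⁻ z, edist z.1 z.2 ^ 2 ∂γ ≤ edist X Y ^ 2 := by
    refine (iInf₂_le _ hγ).trans_eq ?_
    rw [lintegral_map (by fun_prop) (hX.prodMk hY), edist_eq_enorm_sub,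
      ← lintegral_enorm_sq_coeFn_Lp]
    refine lintegral_congr_ae ?_
    filter_upwards [Lp.coeFn_sub X Y] with q hq
    rw [hq, edist_eq_enorm_sub, Pi.sub_apply]
  calc w2 (lawMap P X) (lawMap P Y) ≤ (edist X Y ^ 2) ^ (1 / 2 : ℝ) :=
        ENNReal.rpow_le_rpow h1 (by norm_num)
    _ = edist X Y := by
        rw [← ENNReal.rpow_natCast, ← ENNReal.rpow_mul]
        simp

theorem continuous_lawMap : Continuous (lawMap (H := H) P) := by
  refine ⟨fun U hU => EMetric.isOpen_iff.2 fun X hX => ?_⟩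
  obtain ⟨ε, hε, hU⟩ := hU _ hX
  refine ⟨ε, hε, fun Y hY => hU _ ((w2_lawMap_le P X Y).trans_lt ?_)⟩
  rwa [edist_comm]

end LawMap

/-! ### Characteristic functions on the Wasserstein space -/

section CharFun

theorem norm_exp_inner_sub_le {H : Type*} [NormedAddCommGroup H]
    [InnerProductSpace ℝ H] (t x y : H) :
    ‖Complex.exp (inner ℝ x t * Complex.I) - Complex.exp (inner ℝ y t * Complex.I)‖ ≤
      ‖t‖ * ‖x - y‖ := by
  have h1 := Real.norm_exp_I_mul_ofReal_sub_one_le (x := inner ℝ (x - y) t)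
  have h2 : Complex.exp (inner ℝ x t * Complex.I) - Complex.exp (inner ℝ y t * Complex.I) =
      Complex.exp (inner ℝ y t * Complex.I) *
        (Complex.exp (Complex.I * (inner ℝ (x - y) t : ℝ)) - 1) := by
    rw [mul_sub, ← Complex.exp_add, mul_one, inner_sub_left]
    congr 2
    push_cast
    ring
  rw [h2, norm_mul, Complex.norm_exp_ofReal_mul_I, one_mul]
  refine h1.trans ?_
  rw [mul_comm]
  exact norm_inner_le_norm _ _

variable {H : Type*} [NormedAddCommGroup H] [InnerProductSpace ℝ H] [MeasurableSpace H]
  [BorelSpace H] [SecondCountableTopology H]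

/-- Under any coupling the difference is the mean of a difference of exponentials, which are
`‖t‖`-Lipschitz; Cauchy-Schwarz passes to the quadratic cost. -/
theorem enorm_charFun_sub_le (μ ν : P2 H) (t : H) :
    ‖charFun μ.toMeasure t - charFun ν.toMeasure t‖ₑ ≤ ‖t‖ₑ * w2 μ ν := by
  rcases eq_or_ne t 0 with rfl | ht
  · simp
  have ht0 : ‖t‖ₑ ≠ 0 := by simpa using ht
  have ht1 : ‖t‖ₑ ≠ ∞ := by simp
  -- With `‖t‖` moved to the left, the claim is a lower bound for an infimum and can be checked
  -- coupling by coupling.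
  rw [mul_comm, ← ENNReal.div_le_iff ht0 ht1, w2, one_div, ENNReal.le_rpow_inv_iff (by norm_num)]
  refine le_iInf₂ fun γ hγ => ?_
  rw [← ENNReal.le_rpow_inv_iff (by norm_num), ENNReal.div_le_iff ht0 ht1]
  have hγp : IsProbabilityMeasure γ := by
    constructor
    have := measure_univ (μ := μ.toMeasure)
    rwa [← hγ.1, Measure.map_apply measurable_fst .univ] at this
  have hint : ∀ f : H × H → H, Continuous f →
      Integrable (fun z => Complex.exp (inner ℝ (f z) t * Complex.I)) γ := fun f hf =>
    Integrable.of_bound (C := 1) (Continuous.aestronglyMeasurable (by fun_prop))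
      (by filter_upwards with z; rw [Complex.norm_exp_ofReal_mul_I])
  have h1 : charFun μ.toMeasure t = ∫ z, Complex.exp (inner ℝ z.1 t * Complex.I) ∂γ := by
    rw [charFun_apply, ← hγ.1, integral_map (by fun_prop)
      (Continuous.aestronglyMeasurable (by fun_prop))]
  have h2 : charFun ν.toMeasure t = ∫ z, Complex.exp (inner ℝ z.2 t * Complex.I) ∂γ := by
    rw [charFun_apply, ← hγ.2, integral_map (by fun_prop)
      (Continuous.aestronglyMeasurable (by fun_prop))]
  rw [h1, h2, ← integral_sub (hint _ continuous_fst) (hint _ continuous_snd)]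
  refine (enorm_integral_le_lintegral_enorm _).trans ?_
  calc ∫⁻ z, ‖Complex.exp (inner ℝ z.1 t * Complex.I)
        - Complex.exp (inner ℝ z.2 t * Complex.I)‖ₑ ∂γ
      ≤ ∫⁻ z, ‖t‖ₑ * edist z.1 z.2 ∂γ := by
        refine lintegral_mono fun z => ?_
        rw [edist_eq_enorm_sub, ← enorm_norm (z.1 - z.2), ← enorm_norm t, ← enorm_mul,
          enorm_le_iff_norm_le, Real.norm_of_nonneg (by positivity)]
        exact norm_exp_inner_sub_le t z.1 z.2
    _ = ‖t‖ₑ * ∫⁻ z, edist z.1 z.2 ∂γ := lintegral_const_mul _ (by fun_prop)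
    _ ≤ ‖t‖ₑ * (∫⁻ z, edist z.1 z.2 ^ 2 ∂γ) ^ ((2 : ℝ)⁻¹) := by
        gcongr
        have := eLpNorm_le_eLpNorm_of_exponent_le (μ := γ) (f := fun z : H × H => z.1 - z.2)
          (p := 1) (q := 2) (by norm_num) (Continuous.aestronglyMeasurable (by fun_prop))
        rw [eLpNorm_one_eq_lintegral_enorm,
          eLpNorm_eq_lintegral_rpow_enorm_toReal (by norm_num) (by norm_num)] at this
        simpa [edist_eq_enorm_sub] using this
    _ = _ := mul_comm _ _

theorem continuous_charFun_toMeasure (t : H) :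
    Continuous fun μ : P2 H => charFun μ.toMeasure t := by
  refine ⟨fun U hU μ hμ => ?_⟩
  obtain ⟨ε, hε, hεU⟩ := EMetric.isOpen_iff.1 hU _ hμ
  -- The added 1 covers `t = 0`.
  refine ⟨ε / (‖t‖ₑ + 1), ENNReal.div_pos hε.ne' (by simp), fun ν hν => hεU ?_⟩
  rw [ENNReal.lt_div_iff_mul_lt (by simp) (by simp)] at hν
  rw [Metric.mem_eball, edist_comm, edist_eq_enorm_sub]
  refine (enorm_charFun_sub_le μ ν t).trans_lt (lt_of_le_of_lt ?_ hν)
  rw [mul_comm]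
  gcongr
  exact le_self_add

/-- A Carathéodory function: continuous in the frequency, Borel in the measure. -/
theorem measurable_charFun_toMeasure :
    Measurable fun z : H × P2 H => charFun z.2.toMeasure z.1 := by
  refine measurable_uncurry_of_continuous_of_measurable
    (u := fun (t : H) (μ : P2 H) => charFun μ.toMeasure t) (fun μ => ?_) fun t => ?_
  · exact continuous_charFun
  · exact (continuous_charFun_toMeasure t).measurable

theorem measurable_lintegral_charFun_sq (κ : Measure H) [SFinite κ] :
    Measurable fun μ : P2 H => ∫⁻ u, ‖charFun μ.toMeasure u‖ₑ ^ 2 ∂κ := by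
  refine Measurable.lintegral_prod_left' (f := fun z : H × P2 H =>
    ‖charFun z.2.toMeasure z.1‖ₑ ^ 2) ?_
  exact measurable_charFun_toMeasure.enorm.pow_const 2

theorem P2.isRegular_of_absolutelyContinuous {H : Type*} [NormedAddCommGroup H]
    [InnerProductSpace ℝ H] [FiniteDimensional ℝ H] [MeasurableSpace H] [BorelSpace H] {μ : P2 H}
    (h : μ.toMeasure ≪ volume) : μ.IsRegular :=
  fun _ hS => h (hS.addHaar_eq_zero volume)

end CharFun

/-! ### Karhunen-Loève series -/

section VecMul

variable {Q : Type*} [MeasurableSpace Q] {P : Measure Q} {H : Type*} [NormedAddCommGroup H]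
  [InnerProductSpace ℝ H]

theorem coeFn_vecMul (v : H) (f : Lp ℝ 2 P) : vecMul v f =ᵐ[P] fun q => f q • v := by
  filter_upwards [(ContinuousLinearMap.toSpanSingleton ℝ v).coeFn_compLp f] with q hq
  rw [vecMul, hq, ContinuousLinearMap.toSpanSingleton_apply]

/-- This reduces vector-valued pairings to the scalar coordinate `⟨v, Y⟩`, where the basis of `L²(Q,
P; ℝ)` can be used. -/
theorem inner_vecMul (v : H) (f : Lp ℝ 2 P) (Y : Lp H 2 P) :
    inner ℝ (vecMul v f) Y = inner ℝ f ((innerSL ℝ v).compLp Y) := by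
  rw [L2.inner_def, L2.inner_def]
  refine integral_congr_ae ?_
  filter_upwards [coeFn_vecMul v f, (innerSL ℝ v).coeFn_compLp Y] with q h1 h2
  rw [h1, h2, real_inner_smul_left, innerSL_apply_apply]
  simp [mul_comm]

theorem inner_vecMul_vecMul (v w : H) (f g : Lp ℝ 2 P) :
    inner ℝ (vecMul v f) (vecMul w g) = inner ℝ v w * inner ℝ f g := by
  rw [inner_vecMul, ← real_inner_smul_right]
  congr 1
  ext1
  filter_upwards [coeFn_vecMul w g, (innerSL ℝ v).coeFn_compLp (vecMul w g),
    Lp.coeFn_smul (inner ℝ v w : ℝ) g] with q h1 h2 h3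
  rw [h2, h1, h3, map_smul, innerSL_apply_apply, Pi.smul_apply, smul_eq_mul, smul_eq_mul, mul_comm]

theorem norm_vecMul (v : H) (f : Lp ℝ 2 P) : ‖vecMul v f‖ = ‖v‖ * ‖f‖ := by
  rw [← sq_eq_sq₀ (norm_nonneg _) (by positivity), mul_pow, ← real_inner_self_eq_norm_sq,
    inner_vecMul_vecMul, real_inner_self_eq_norm_sq, real_inner_self_eq_norm_sq]

/-- The map `v ↦ v f` for a unit vector `f`, as a linear isometry. -/
noncomputable def vecMulₗᵢ (f : Lp ℝ 2 P) (hf : ‖f‖ = 1) : H →ₗᵢ[ℝ] Lp H 2 P where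
  toFun v := vecMul v f
  map_add' v w := by
    ext1
    filter_upwards [coeFn_vecMul (v + w) f, coeFn_vecMul v f, coeFn_vecMul w f,
      Lp.coeFn_add (vecMul v f) (vecMul w f)] with q h1 h2 h3 h4
    rw [h1, h4, Pi.add_apply, h2, h3, smul_add]
  map_smul' c v := by
    ext1
    filter_upwards [coeFn_vecMul (c • v) f, coeFn_vecMul v f,
      Lp.coeFn_smul c (vecMul v f)] with q h1 h2 h3
    rw [RingHom.id_apply, h1, h3, Pi.smul_apply, h2, smul_comm]
  norm_map' v := by
    change ‖vecMul v f‖ = ‖v‖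
    rw [norm_vecMul, hf, mul_one]

@[simp]
theorem vecMulₗᵢ_apply (f : Lp ℝ 2 P) (hf : ‖f‖ = 1) (v : H) : vecMulₗᵢ f hf v = vecMul v f := rfl

theorem orthogonalFamily_vecMul {ι : Type*} {e : ι → Lp ℝ 2 P} (he : Orthonormal ℝ e) :
    OrthogonalFamily ℝ (fun _ : ι => H) fun i => vecMulₗᵢ (e i) (he.1 i) := by
  intro i j hij v w
  rw [vecMulₗᵢ_apply, vecMulₗᵢ_apply, inner_vecMul_vecMul, he.2 hij, mul_zero]

/-- A vector of `L²(Q, P; H)` orthogonal to all `v Eₙ` vanishes. -/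
theorem eq_zero_of_forall_inner_vecMul [FiniteDimensional ℝ H] {ι : Type*}
    (e : HilbertBasis ι ℝ (Lp ℝ 2 P)) {Y : Lp H 2 P}
    (h : ∀ i v, inner ℝ (vecMul v (e i)) Y = 0) : Y = 0 := by
  have h1 : ∀ v : H, (innerSL ℝ v).compLp Y = 0 := by
    intro v
    refine (e.repr.map_eq_zero_iff).1 ?_
    ext i
    rw [e.repr_apply_apply, ← inner_vecMul, h]
    rfl
  have h2 : ∀ᵐ q ∂P, ∀ i, inner ℝ (stdOrthonormalBasis ℝ H i) (Y q) = 0 := by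
    rw [ae_all_iff]
    intro i
    filter_upwards [(innerSL ℝ (stdOrthonormalBasis ℝ H i)).coeFn_compLp Y,
      Lp.coeFn_zero ℝ 2 P] with q hq h0
    rw [h1, h0] at hq
    simpa using hq.symm
  ext1
  filter_upwards [h2, Lp.coeFn_zero H 2 P] with q hq h0
  rw [h0]
  exact InnerProductSpace.ext_inner_left_basis (𝕜 := ℝ) (stdOrthonormalBasis ℝ H).toBasis
    fun i => by simp [hq i]

/-- Squared norm of an orthogonal series. -/
theorem enorm_sq_tsum_vecMul {e : ℕ → Lp ℝ 2 P} (he : Orthonormal ℝ e) {x : ℕ → H}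
    (hx : Summable fun n => vecMul (x n) (e n)) :
    ‖∑' n, vecMul (x n) (e n)‖ₑ ^ 2 = ∑' n, ‖x n‖ₑ ^ 2 := by
  have h1 := ((continuous_enorm.tendsto _).comp hx.hasSum.tendsto_sum_nat).ennrpow_const 2
  refine tendsto_nhds_unique (by simpa using h1)
    ((ENNReal.tendsto_nat_tsum fun n => ‖x n‖ₑ ^ 2).congr fun N => ?_)
  have h2 := (orthogonalFamily_vecMul (H := H) he).norm_sum x (Finset.range N)
  simp only [vecMulₗᵢ_apply] at h2
  rw [← enorm_norm (∑ i ∈ _, _), Real.enorm_of_nonneg (norm_nonneg _),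
    ← ENNReal.ofReal_pow (norm_nonneg _), h2,
    ENNReal.ofReal_sum_of_nonneg (fun _ _ => by positivity)]
  refine Finset.sum_congr rfl fun i _ => ?_
  rw [ENNReal.ofReal_pow (norm_nonneg _), ofReal_norm]

end VecMul

/-! ### Finite-dimensional Gaussian vectors -/

section Gaussian

variable {d : ℕ} {Ω : Type*} [MeasurableSpace Ω] {Pr : Measure Ω}
  {S : ℕ → Matrix (Fin d) (Fin d) ℝ} {ξ : ℕ → Ω → EuclideanSpace ℝ (Fin d)}

theorem dotProduct_mulVec_eq_smul (A : Matrix (Fin d) (Fin d) ℝ) (a : ℝ)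
    (c : EuclideanSpace ℝ (Fin d)) :
    (A *ᵥ (a • c).ofLp) ⬝ᵥ (a • c).ofLp = a ^ 2 * ((A *ᵥ c.ofLp) ⬝ᵥ c.ofLp) := by
  rw [WithLp.ofLp_smul, Matrix.mulVec_smul, smul_dotProduct, dotProduct_smul]
  simp only [smul_eq_mul]
  ring

theorem dotProduct_mulVec_le {A : Matrix (Fin d) (Fin d) ℝ} {b : ℝ}
    (hA : ∀ v : EuclideanSpace ℝ (Fin d), ‖v‖ = 1 → (A *ᵥ v.ofLp) ⬝ᵥ v.ofLp ≤ b)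
    (c : EuclideanSpace ℝ (Fin d)) : (A *ᵥ c.ofLp) ⬝ᵥ c.ofLp ≤ b * ‖c‖ ^ 2 := by
  rcases eq_or_ne c 0 with rfl | hc
  · simp
  have hn : ‖c‖ ≠ 0 := norm_ne_zero_iff.2 hc
  have h := hA (‖c‖⁻¹ • c) (by rw [norm_smul, norm_inv, norm_norm, inv_mul_cancel₀ hn])
  rw [dotProduct_mulVec_eq_smul, inv_pow, inv_mul_le_iff₀ (by positivity)] at h
  linarith

theorem le_dotProduct_mulVec {A : Matrix (Fin d) (Fin d) ℝ} {a : ℝ}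
    (hA : ∀ v : EuclideanSpace ℝ (Fin d), ‖v‖ = 1 → a ≤ (A *ᵥ v.ofLp) ⬝ᵥ v.ofLp)
    (c : EuclideanSpace ℝ (Fin d)) : a * ‖c‖ ^ 2 ≤ (A *ᵥ c.ofLp) ⬝ᵥ c.ofLp := by
  have h := dotProduct_mulVec_le (A := -A) (b := -a) (fun v hv => by
    rw [Matrix.neg_mulVec, neg_dotProduct]
    exact neg_le_neg (hA v hv)) c
  rw [Matrix.neg_mulVec, neg_dotProduct] at h
  linarith

/-- The joint characteristic function of independent centered Gaussian vectors. -/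
theorem integral_exp_sum_inner (hS : ∀ n, (S n).PosSemidef)
    (hξ : ∀ n, HasLaw (ξ n) (multivariateGaussian 0 (S n)) Pr) (hind : iIndepFun ξ Pr)
    (c : ℕ → EuclideanSpace ℝ (Fin d)) (N : ℕ) :
    ∫ ω, Complex.exp ((∑ n ∈ Finset.range N, inner ℝ (ξ n ω) (c n) : ℝ) * Complex.I) ∂Pr =
      Complex.exp (-(∑ n ∈ Finset.range N, (S n *ᵥ (c n).ofLp) ⬝ᵥ (c n).ofLp : ℝ) / 2) := by
  have h1 := iIndepFun.integral_fun_prod_comp (X := fun i : Finset.range N => ξ i)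
    (hind.precomp (g := ((↑) : Finset.range N → ℕ)) Subtype.val_injective)
    (fun i => (hξ i).aemeasurable)
    (f := fun i x => Complex.exp ((inner ℝ x (c i) : ℝ) * Complex.I))
    (fun i => Continuous.aestronglyMeasurable (by fun_prop))
  have h2 : ∀ n, ∫ ω, Complex.exp ((inner ℝ (ξ n ω) (c n) : ℝ) * Complex.I) ∂Pr =
      Complex.exp (-((S n *ᵥ (c n).ofLp) ⬝ᵥ (c n).ofLp : ℝ) / 2) := by
    intro n
    have := charFun_multivariateGaussian (μ := 0) (hS n) (c n)
    rw [← (hξ n).map_eq, charFun_apply, integral_map (hξ n).aemeasurable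
      (Continuous.aestronglyMeasurable (by fun_prop))] at this
    rw [this, inner_zero_right, dotProduct_comm]
    congr 1
    push_cast
    ring
  simp_rw [h2] at h1
  rw [Finset.prod_coe_sort (Finset.range N)
    (fun n => Complex.exp (-((S n *ᵥ (c n).ofLp) ⬝ᵥ (c n).ofLp : ℝ) / 2)),
    ← Complex.exp_sum] at h1
  calc _ = _ := by
        refine integral_congr_ae (Filter.Eventually.of_forall fun ω => ?_)
        simp only
        rw [Finset.prod_coe_sort (Finset.range N)
          (fun n => Complex.exp ((inner ℝ (ξ n ω) (c n) : ℝ) * Complex.I)), ← Complex.exp_sum]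
        congr 1
        push_cast
        rw [Finset.sum_mul]
    _ = _ := h1
    _ = _ := by
        congr 1
        push_cast
        rw [← Finset.sum_neg_distrib, Finset.sum_div]

/-- Second moment of a centered Gaussian vector. -/
theorem lintegral_enorm_sq_multivariateGaussian_le {A : Matrix (Fin d) (Fin d) ℝ}
    (hA : A.PosSemidef) {b : ℝ}
    (hb : ∀ v : EuclideanSpace ℝ (Fin d), ‖v‖ = 1 → (A *ᵥ v.ofLp) ⬝ᵥ v.ofLp ≤ b) :
    ∫⁻ x, ‖x‖ₑ ^ 2 ∂(multivariateGaussian 0 A) ≤ d * ENNReal.ofReal b := by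
  have h1 : ∀ x : EuclideanSpace ℝ (Fin d), ‖x‖ₑ ^ 2 = ∑ i, ‖x i‖ₑ ^ 2 := by
    intro x
    rw [← enorm_norm, Real.enorm_of_nonneg (norm_nonneg _), ← ENNReal.ofReal_pow (norm_nonneg _),
      EuclideanSpace.norm_sq_eq, ENNReal.ofReal_sum_of_nonneg (fun _ _ => by positivity)]
    refine Finset.sum_congr rfl fun i _ => ?_
    rw [ENNReal.ofReal_pow (norm_nonneg _), ofReal_norm]
  simp_rw [h1]
  rw [lintegral_finsetSum _ (fun i _ => by fun_prop)]
  refine (Finset.sum_le_card_nsmul _ _ (ENNReal.ofReal b) fun i _ => ?_).trans_eq (by simp)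
  have hm : MemLp (fun x : EuclideanSpace ℝ (Fin d) => x i) 2 (multivariateGaussian 0 A) :=
    IsGaussian.memLp_dual _ (EuclideanSpace.proj i) 2 (by simp)
  have hv := variance_eval_multivariateGaussian (μ := 0) hA i
  have hmean : ∫ x, x i ∂(multivariateGaussian 0 A) = 0 := by
    have := (EuclideanSpace.proj i : EuclideanSpace ℝ (Fin d) →L[ℝ] ℝ).integral_comp_id_comm
      (μ := multivariateGaussian 0 A) IsGaussian.integrable_id
    simpa using this
  have he : eVar[fun x : EuclideanSpace ℝ (Fin d) => x i; multivariateGaussian 0 A] =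
      ENNReal.ofReal (A i i) := by
    rw [← hv, hm.ofReal_variance_eq]
  rw [evariance, hmean] at he
  simp only [sub_zero] at he
  rw [he]
  refine ENNReal.ofReal_le_ofReal ?_
  -- The second moment is the trace; each of its `d` diagonal entries is the quadratic form at a
  -- unit basis vector.
  have := hb (EuclideanSpace.single i 1) (by simp)
  simpa using this

end Gaussian

/-! ### Convergence and Gaussianity of the random series -/

section KarhunenLoeve

variable {Q : Type*} [MeasurableSpace Q] {P : Measure Q} {d : ℕ}

theorem tendsto_sum_vecMul_klVector {e : HilbertBasis ℕ ℝ (Lp ℝ 2 P)} {Ω : Type*}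
    {ξ : ℕ → Ω → EuclideanSpace ℝ (Fin d)} {ω : Ω} (h : Summable fun n => vecMul (ξ n ω) (e n)) :
    Filter.Tendsto (fun N => ∑ n ∈ Finset.range N, vecMul (ξ n ω) (e n)) Filter.atTop
      (nhds (klVector ξ e ω)) :=
  h.hasSum.tendsto_sum_nat

variable {Ω : Type*} [MeasurableSpace Ω]
  {Pr : Measure Ω} {e : HilbertBasis ℕ ℝ (Lp ℝ 2 P)} {S : ℕ → Matrix (Fin d) (Fin d) ℝ}
  {α β : ℕ → ℝ} {ξ : ℕ → Ω → EuclideanSpace ℝ (Fin d)}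

theorem tsum_lintegral_enorm_sq_lt_top (hS : ∀ n, (S n).PosSemidef)
    (hSβ : ∀ n (v : EuclideanSpace ℝ (Fin d)), ‖v‖ = 1 →
      (S n *ᵥ v.ofLp) ⬝ᵥ v.ofLp ≤ β n ^ 2)
    (hβ : Summable fun n => β n ^ 2)
    (hξ : ∀ n, HasLaw (ξ n) (multivariateGaussian 0 (S n)) Pr) :
    ∑' n, ∫⁻ ω, ‖ξ n ω‖ₑ ^ 2 ∂Pr < ∞ := by
  have h1 : ∀ n, ∫⁻ ω, ‖ξ n ω‖ₑ ^ 2 ∂Pr ≤ d * ENNReal.ofReal (β n ^ 2) := by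
    intro n
    rw [← lintegral_map' (f := fun x => ‖x‖ₑ ^ 2) (by fun_prop) (hξ n).aemeasurable, (hξ n).map_eq]
    exact lintegral_enorm_sq_multivariateGaussian_le (hS n) (hSβ n)
  refine (ENNReal.tsum_le_tsum h1).trans_lt ?_
  rw [ENNReal.tsum_mul_left]
  exact ENNReal.mul_lt_top (by simp) hβ.tsum_ofReal_lt_top

theorem ae_tsum_enorm_sq_lt_top (hξm : ∀ n, AEMeasurable (ξ n) Pr)
    (h : ∑' n, ∫⁻ ω, ‖ξ n ω‖ₑ ^ 2 ∂Pr < ∞) : ∀ᵐ ω ∂Pr, ∑' n, ‖ξ n ω‖ₑ ^ 2 < ∞ := by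
  have hm : ∀ n, AEMeasurable (fun ω => ‖ξ n ω‖ₑ ^ 2) Pr := fun n =>
    (hξm n).enorm.pow_const 2
  rw [← lintegral_tsum hm] at h
  exact ae_lt_top' (AEMeasurable.tsum hm) h.ne

/-- By orthogonality the series converges exactly when `∑ |ξₙ|²` is finite, and this sum has finite
expectation. -/
theorem ae_summable_vecMul (hξm : ∀ n, AEMeasurable (ξ n) Pr)
    (h : ∑' n, ∫⁻ ω, ‖ξ n ω‖ₑ ^ 2 ∂Pr < ∞) :
    ∀ᵐ ω ∂Pr, Summable fun n => vecMul (ξ n ω) (e n) := by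
  filter_upwards [ae_tsum_enorm_sq_lt_top hξm h] with ω hω
  have h1 := (orthogonalFamily_vecMul (H := EuclideanSpace ℝ (Fin d))
    e.orthonormal).summable_iff_norm_sq_summable fun n => ξ n ω
  simp only [vecMulₗᵢ_apply] at h1
  rw [h1]
  refine (ENNReal.summable_toReal hω.ne).congr fun n => ?_
  simp

theorem lintegral_enorm_sq_klVector (hξm : ∀ n, AEMeasurable (ξ n) Pr)
    (h : ∑' n, ∫⁻ ω, ‖ξ n ω‖ₑ ^ 2 ∂Pr < ∞) :
    ∫⁻ ω, ‖klVector ξ e ω‖ₑ ^ 2 ∂Pr = ∑' n, ∫⁻ ω, ‖ξ n ω‖ₑ ^ 2 ∂Pr := by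
  rw [← lintegral_tsum fun n => (hξm n).enorm.pow_const 2]
  refine lintegral_congr_ae ?_
  filter_upwards [ae_summable_vecMul (e := e) hξm h] with ω hω
  exact enorm_sq_tsum_vecMul e.orthonormal hω

theorem measurable_vecMul (f : Lp ℝ 2 P) (hf : ‖f‖ = 1) :
    Measurable fun v : EuclideanSpace ℝ (Fin d) => vecMul v f :=
  (vecMulₗᵢ f hf).continuous.measurable

variable [MeasurableSpace.CountablyGenerated Q] [IsProbabilityMeasure P]

theorem aemeasurable_sum_vecMul (hξm : ∀ n, AEMeasurable (ξ n) Pr) (N : ℕ) :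
    AEMeasurable (fun ω => ∑ n ∈ Finset.range N, vecMul (ξ n ω) (e n)) Pr :=
  -- Finiteness of the exponent gives separability of `L²`, needed for measurability of sums.
  have : Fact ((2 : ℝ≥0∞) ≠ ∞) := ⟨by simp⟩
  Finset.aemeasurable_fun_sum _ fun n _ =>
    (measurable_vecMul (e n) (e.orthonormal.1 n)).comp_aemeasurable (hξm n)

theorem aemeasurable_klVector (hξm : ∀ n, AEMeasurable (ξ n) Pr)
    (h : ∑' n, ∫⁻ ω, ‖ξ n ω‖ₑ ^ 2 ∂Pr < ∞) : AEMeasurable (klVector ξ e) Pr := by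
  refine aemeasurable_of_tendsto_metrizable_ae Filter.atTop
    (aemeasurable_sum_vecMul (e := e) hξm) ?_
  filter_upwards [ae_summable_vecMul (e := e) hξm h] with ω hω
  exact tendsto_sum_vecMul_klVector hω

/-- The characteristic function of the law of a Karhunen-Loève series. -/
theorem exists_charFun_map_klVector [IsProbabilityMeasure Pr] (hS : ∀ n, (S n).PosSemidef)
    (hα : ∀ n, 0 < α n ^ 2)
    (hαS : ∀ n (v : EuclideanSpace ℝ (Fin d)), ‖v‖ = 1 →
      α n ^ 2 ≤ (S n *ᵥ v.ofLp) ⬝ᵥ v.ofLp)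
    (hSβ : ∀ n (v : EuclideanSpace ℝ (Fin d)), ‖v‖ = 1 →
      (S n *ᵥ v.ofLp) ⬝ᵥ v.ofLp ≤ β n ^ 2)
    (hβ : Summable fun n => β n ^ 2)
    (hξ : ∀ n, HasLaw (ξ n) (multivariateGaussian 0 (S n)) Pr) (hind : iIndepFun ξ Pr)
    (Y : Lp (EuclideanSpace ℝ (Fin d)) 2 P) :
    ∃ s : ℝ, 0 ≤ s ∧ (Y ≠ 0 → 0 < s) ∧ ∀ t : ℝ,
      ∫ ω, Complex.exp ((t * inner ℝ Y (klVector ξ e ω) : ℝ) * Complex.I) ∂Pr =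
        Complex.exp (-(t ^ 2 * s : ℝ) / 2) := by
  have hξm : ∀ n, AEMeasurable (ξ n) Pr := fun n => (hξ n).aemeasurable
  have hfin := tsum_lintegral_enorm_sq_lt_top hS hSβ hβ hξ
  set V := fun n => vecMulₗᵢ (H := EuclideanSpace ℝ (Fin d)) (e n) (e.orthonormal.1 n)
  -- `c n` is the vector coefficient of `Y` along `Eₙ`. The pairing of `Y` with the series is `∑
  -- ⟨ξₙ, cₙ⟩`, of variance `∑ Sₙ cₙ · cₙ`.
  set c : ℕ → EuclideanSpace ℝ (Fin d) := fun n =>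
    ContinuousLinearMap.adjoint (V n).toContinuousLinearMap Y
  have hc : ∀ n v, inner ℝ Y (vecMul v (e n)) = inner ℝ v (c n) := fun n v => by
    rw [ContinuousLinearMap.adjoint_inner_right, real_inner_comm]
    rfl
  have hcn : ∀ n, ‖c n‖ ≤ ‖Y‖ := fun n => by
    refine (ContinuousLinearMap.le_opNorm _ _).trans ?_
    rw [LinearIsometryEquiv.norm_map]
    exact mul_le_of_le_one_left (norm_nonneg _) (V n).norm_toContinuousLinearMap_le
  set s : ℕ → ℝ := fun n => (S n *ᵥ (c n).ofLp) ⬝ᵥ (c n).ofLp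
  have hs0 : ∀ n, α n ^ 2 * ‖c n‖ ^ 2 ≤ s n := fun n => le_dotProduct_mulVec (hαS n) (c n)
  have hsn : ∀ n, 0 ≤ s n := fun n => (by positivity : (0 : ℝ) ≤ _).trans (hs0 n)
  have hsum : Summable s := by
    refine Summable.of_nonneg_of_le hsn (fun n => ?_) (hβ.mul_right (‖Y‖ ^ 2))
    refine (dotProduct_mulVec_le (hSβ n) (c n)).trans ?_
    gcongr
    exact hcn n
  refine ⟨∑' n, s n, tsum_nonneg hsn, fun hY => ?_, fun t => ?_⟩
  -- A nonzero `Y` has a nonzero coefficient, which contributes at least `αₙ² |cₙ|² > 0` to the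
  -- variance.
  · obtain ⟨n, hn⟩ : ∃ n, c n ≠ 0 := by
      by_contra! h0
      refine hY (eq_zero_of_forall_inner_vecMul e fun n v => ?_)
      rw [real_inner_comm, hc, h0, inner_zero_right]
    exact hsum.tsum_pos hsn n ((mul_pos (hα n) (pow_pos (norm_pos_iff.2 hn) 2)).trans_le (hs0 n))
  · have h1 : ∀ N, ∫ ω, Complex.exp ((t * inner ℝ Y
        (∑ n ∈ Finset.range N, vecMul (ξ n ω) (e n)) : ℝ) * Complex.I) ∂Pr =
          Complex.exp (-(t ^ 2 * ∑ n ∈ Finset.range N, s n : ℝ) / 2) := by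
      intro N
      have := integral_exp_sum_inner hS hξ hind (fun n => t • c n) N
      simp_rw [dotProduct_mulVec_eq_smul, ← Finset.mul_sum, real_inner_smul_right,
        ← Finset.mul_sum, ← hc, ← inner_sum] at this
      exact this
    have h2 : Filter.Tendsto (fun N => ∫ ω, Complex.exp ((t * inner ℝ Y
        (∑ n ∈ Finset.range N, vecMul (ξ n ω) (e n)) : ℝ) * Complex.I) ∂Pr) Filter.atTop
        (nhds (∫ ω, Complex.exp ((t * inner ℝ Y (klVector ξ e ω) : ℝ) * Complex.I) ∂Pr)) := by
      have hcont : Continuous fun X : Lp (EuclideanSpace ℝ (Fin d)) 2 P =>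
        Complex.exp ((t * inner ℝ Y X : ℝ) * Complex.I) := by fun_prop
      refine tendsto_integral_of_dominated_convergence (fun _ => 1) (fun N => ?_)
        (integrable_const 1) (fun N => Filter.Eventually.of_forall fun ω => ?_) ?_
      · exact (hcont.measurable.comp_aemeasurable
          (aemeasurable_sum_vecMul hξm N)).aestronglyMeasurable
      · rw [Complex.norm_exp_ofReal_mul_I]
      · filter_upwards [ae_summable_vecMul (e := e) hξm hfin] with ω hω
        exact (hcont.tendsto _).comp (tendsto_sum_vecMul_klVector hω)
    simp_rw [h1] at h2
    refine tendsto_nhds_unique h2 ?_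
    have hcont : Continuous fun x : ℝ => Complex.exp (-(t ^ 2 * x : ℝ) / 2) := by fun_prop
    exact (hcont.tendsto _).comp hsum.hasSum.tendsto_sum_nat

/-- The law of a Karhunen-Loève series is a nondegenerate Gaussian measure. -/
theorem isNondegenerateGaussian_map_klVector [IsProbabilityMeasure Pr]
    (hS : ∀ n, (S n).PosSemidef) (hα : ∀ n, 0 < α n ^ 2)
    (hαS : ∀ n (v : EuclideanSpace ℝ (Fin d)), ‖v‖ = 1 →
      α n ^ 2 ≤ (S n *ᵥ v.ofLp) ⬝ᵥ v.ofLp)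
    (hSβ : ∀ n (v : EuclideanSpace ℝ (Fin d)), ‖v‖ = 1 →
      (S n *ᵥ v.ofLp) ⬝ᵥ v.ofLp ≤ β n ^ 2)
    (hβ : Summable fun n => β n ^ 2)
    (hξ : ∀ n, HasLaw (ξ n) (multivariateGaussian 0 (S n)) Pr) (hind : iIndepFun ξ Pr) :
    IsNondegenerateGaussian (Pr.map (klVector ξ e)) := by
  have hm : AEMeasurable (klVector ξ e) Pr := aemeasurable_klVector
    (fun n => (hξ n).aemeasurable) (tsum_lintegral_enorm_sq_lt_top hS hSβ hβ hξ)
  have := Measure.isProbabilityMeasure_map hm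
  have key : ∀ L : StrongDual ℝ (Lp (EuclideanSpace ℝ (Fin d)) 2 P),
      ∃ s : ℝ≥0, (L ≠ 0 → 0 < s) ∧ (Pr.map (klVector ξ e)).map L = gaussianReal 0 s := by
    intro L
    obtain ⟨Y, rfl⟩ := (InnerProductSpace.toDual ℝ _).surjective L
    obtain ⟨s, hs0, hs, h⟩ := exists_charFun_map_klVector (e := e) hS hα hαS hSβ hβ hξ hind Y
    lift s to ℝ≥0 using hs0
    refine ⟨s, fun hY => by simpa using hs (by simpa using hY), ?_⟩
    refine Measure.ext_of_charFun (funext fun t => ?_)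
    rw [charFun_gaussianReal, charFun_apply_real, integral_map (by fun_prop)
      (Continuous.aestronglyMeasurable (by fun_prop)), integral_map hm
      (Continuous.aestronglyMeasurable (by fun_prop))]
    refine Eq.trans (integral_congr_ae (Filter.Eventually.of_forall fun ω => ?_)) ((h t).trans ?_)
    · simp
    · congr 1
      push_cast
      simp
      ring
  have hG : IsGaussian (Pr.map (klVector ξ e)) := isGaussian_of_map_eq_gaussianReal fun L => by
    obtain ⟨s, -, hs⟩ := key L
    exact ⟨0, s, hs⟩
  refine ⟨hG, fun L hL => ?_⟩
  obtain ⟨s, hs0, hs⟩ := key L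
  have h1 : Var[id; (Pr.map (klVector ξ e)).map L] = s := by rw [hs, variance_id_gaussianReal]
  rw [variance_map aemeasurable_id (by fun_prop)] at h1
  rw [← Function.id_comp L, h1]
  exact hs0 hL

end KarhunenLoeve

/-! ### Berman's condition -/

/-- The Gaussian integral over `ℝ^d`, as a bound valid also for vanishing variance. -/
theorem lintegral_exp_neg_mul_sq_norm_le {d : ℕ} (hd : 1 ≤ d) {s : ℝ} (hs : 0 ≤ s) :
    ∫⁻ u : EuclideanSpace ℝ (Fin d), ENNReal.ofReal (Real.exp (-(s * ‖u‖ ^ 2 / 2))) ≤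
      ENNReal.ofReal ((2 * Real.pi) ^ ((d : ℝ) / 2)) *
        ((ENNReal.ofReal s ^ (1 / 2 : ℝ)) ^ d)⁻¹ := by
  rcases hs.eq_or_lt with rfl | hs
  -- For `s = 0` the right side is `∞`; `d ≥ 1` ensures `0 ^ d = 0`.
  · rw [ENNReal.ofReal_zero, ENNReal.zero_rpow_of_pos (by norm_num), zero_pow (by omega),
      ENNReal.inv_zero, ENNReal.mul_top]
    · exact le_top
    · rw [ne_eq, ENNReal.ofReal_eq_zero, not_le]
      positivity
  · have h1 := GaussianFourier.integral_rexp_neg_mul_sq_norm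
      (V := EuclideanSpace ℝ (Fin d)) (b := s / 2) (by positivity)
    rw [finrank_euclideanSpace_fin] at h1
    have hpos : 0 < (Real.pi / (s / 2)) ^ ((d : ℝ) / 2) := by positivity
    -- A non-integrable function would have integral 0, contradicting the positive value in `h1`.
    have hint : Integrable fun u : EuclideanSpace ℝ (Fin d) => Real.exp (-(s / 2) * ‖u‖ ^ 2) := by
      by_contra h
      rw [integral_undef h] at h1
      exact hpos.ne h1
    have h2 : ∀ u : EuclideanSpace ℝ (Fin d), -(s * ‖u‖ ^ 2 / 2) = -(s / 2) * ‖u‖ ^ 2 :=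
      fun u => by ring
    simp_rw [h2]
    rw [← ofReal_integral_eq_lintegral_ofReal hint
      (Filter.Eventually.of_forall fun _ => (Real.exp_pos _).le), h1,
      ENNReal.ofReal_rpow_of_pos hs, ← ENNReal.ofReal_pow (by positivity),
      ← ENNReal.ofReal_inv_of_pos (by positivity), ← ENNReal.ofReal_mul (by positivity)]
    refine ENNReal.ofReal_le_ofReal (le_of_eq ?_)
    rw [← Real.rpow_mul_natCast hs.le, ← Real.rpow_neg hs.le, show Real.pi / (s / 2) =
      2 * Real.pi * s⁻¹ by field_simp, Real.mul_rpow (by positivity) (by positivity),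
      Real.inv_rpow hs.le, ← Real.rpow_neg hs.le]
    congr 2
    ring

section Berman

variable {Q : Type*} [MeasurableSpace Q] {P : Measure Q} {d : ℕ}

/-- The partial sums of `α(q₁, q₂)²`. -/
noncomputable def partialKernel (α : ℕ → ℝ) (e : ℕ → Lp ℝ 2 P) (N : ℕ) (q : Q × Q) : ℝ :=
  ∑ n ∈ Finset.range N, α n ^ 2 * (e n q.1 - e n q.2) ^ 2

theorem partialKernel_nonneg (α : ℕ → ℝ) (e : ℕ → Lp ℝ 2 P) (N : ℕ) (q : Q × Q) :
    0 ≤ partialKernel α e N q :=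
  Finset.sum_nonneg fun _ _ => by positivity

theorem monotone_partialKernel (α : ℕ → ℝ) (e : ℕ → Lp ℝ 2 P) (q : Q × Q) :
    Monotone fun N => partialKernel α e N q := fun M N h =>
  Finset.sum_le_sum_of_subset_of_nonneg (Finset.range_subset_range.2 h) fun _ _ _ => by positivity

theorem measurable_partialKernel (α : ℕ → ℝ) (e : ℕ → Lp ℝ 2 P) (N : ℕ) :
    Measurable (partialKernel α e N) := by
  have he : ∀ n, Measurable (e n) := fun n => (Lp.stronglyMeasurable (e n)).measurable
  exact Finset.measurable_fun_sum _ fun n _ => ((((he n).comp measurable_fst).sub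
    ((he n).comp measurable_snd)).pow_const 2).const_mul _

theorem tendsto_ofReal_partialKernel (α : ℕ → ℝ) (e : ℕ → Lp ℝ 2 P) (q : Q × Q) :
    Filter.Tendsto (fun N => ENNReal.ofReal (partialKernel α e N q) ^ (1 / 2 : ℝ)) Filter.atTop
      (nhds (alphaKernel α e q.1 q.2)) := by
  refine Filter.Tendsto.ennrpow_const _ ?_
  refine (ENNReal.tendsto_nat_tsum _).congr fun N => ?_
  rw [partialKernel, ENNReal.ofReal_sum_of_nonneg fun _ _ => by positivity]

/-- Each partial kernel gives a bound, and inversion is continuous on `[0, ∞]`, so the limit also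
covers `α = 0` and `α = ∞`. -/
theorem lintegral_iInf_exp_le (hd : 1 ≤ d) (α : ℕ → ℝ) (e : ℕ → Lp ℝ 2 P) (q : Q × Q) :
    ∫⁻ u : EuclideanSpace ℝ (Fin d),
        ⨅ N, ENNReal.ofReal (Real.exp (-(partialKernel α e N q * ‖u‖ ^ 2 / 2))) ≤
      ENNReal.ofReal ((2 * Real.pi) ^ ((d : ℝ) / 2)) * (alphaKernel α e q.1 q.2 ^ d)⁻¹ := by
  have h1 := ENNReal.Tendsto.const_mul (a := ENNReal.ofReal ((2 * Real.pi) ^ ((d : ℝ) / 2)))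
    (tendsto_inv_iff.2 (((ENNReal.continuous_pow d).tendsto _).comp
      (tendsto_ofReal_partialKernel α e q))) (Or.inr ENNReal.ofReal_ne_top)
  refine ge_of_tendsto' h1 fun N => ?_
  exact (lintegral_mono fun u => iInf_le _ N).trans
    (lintegral_exp_neg_mul_sq_norm_le hd (partialKernel_nonneg α e N q))

theorem coeFn_sum_vecMul (x : ℕ → EuclideanSpace ℝ (Fin d)) (e : ℕ → Lp ℝ 2 P) (N : ℕ) :
    (∑ n ∈ Finset.range N, vecMul (x n) (e n) : Lp (EuclideanSpace ℝ (Fin d)) 2 P) =ᵐ[P]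
      fun q => ∑ n ∈ Finset.range N, e n q • x n := by
  filter_upwards [Lp.coeFn_finsetSum (Finset.range N) fun n => vecMul (x n) (e n),
    ae_all_iff.2 fun n => coeFn_vecMul (x n) (e n)] with q h1 h2
  rw [h1, Finset.sum_apply]
  exact Finset.sum_congr rfl fun n _ => h2 n

variable {Ω : Type*} [MeasurableSpace Ω] {Pr : Measure Ω} {e : HilbertBasis ℕ ℝ (Lp ℝ 2 P)}
  {S : ℕ → Matrix (Fin d) (Fin d) ℝ} {α β : ℕ → ℝ} {ξ : ℕ → Ω → EuclideanSpace ℝ (Fin d)}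
  [IsProbabilityMeasure P] [IsProbabilityMeasure Pr]

theorem charFun_lawMap (X : Lp (EuclideanSpace ℝ (Fin d)) 2 P) (u : EuclideanSpace ℝ (Fin d)) :
    charFun (lawMap P X).toMeasure u = ∫ q, Complex.exp ((inner ℝ (X q) u : ℝ) * Complex.I) ∂P := by
  rw [charFun_apply]
  exact integral_map (Lp.stronglyMeasurable X).measurable.aemeasurable
    (Continuous.aestronglyMeasurable (by fun_prop))

/-- The conjugate factor is the characteristic function at `-u`, and Fubini merges the two
integrals. -/
theorem normSq_charFun_lawMap (X : Lp (EuclideanSpace ℝ (Fin d)) 2 P)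
    (u : EuclideanSpace ℝ (Fin d)) :
    ((‖charFun (lawMap P X).toMeasure u‖ ^ 2 : ℝ) : ℂ) =
      ∫ q : Q × Q, Complex.exp ((inner ℝ (X q.1 - X q.2) u : ℝ) * Complex.I) ∂(P.prod P) := by
  rw [← Complex.normSq_eq_norm_sq, Complex.normSq_eq_conj_mul_self, mul_comm, ← charFun_neg,
    charFun_lawMap, charFun_lawMap, ← integral_prod_mul]
  refine integral_congr_ae (Filter.Eventually.of_forall fun q => ?_)
  simp only
  rw [← Complex.exp_add, inner_sub_left, inner_neg_right]
  congr 1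
  push_cast
  ring

/-- For fixed `(q₁, q₂)` the increment of a finite sum is a combination of the independent `ξₙ`, so
exchanging the integrals leaves a Gaussian characteristic function. -/
theorem integral_normSq_charFun_sum (hS : ∀ n, (S n).PosSemidef)
    (hξ : ∀ n, HasLaw (ξ n) (multivariateGaussian 0 (S n)) Pr) (hind : iIndepFun ξ Pr)
    (e : ℕ → Lp ℝ 2 P) (N : ℕ) (u : EuclideanSpace ℝ (Fin d)) :
    ∫ ω, ‖charFun (lawMap P (∑ n ∈ Finset.range N, vecMul (ξ n ω) (e n))).toMeasure u‖ ^ 2 ∂Pr =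
      ∫ q : Q × Q, Real.exp (-(∑ n ∈ Finset.range N,
        (e n q.1 - e n q.2) ^ 2 * ((S n *ᵥ u.ofLp) ⬝ᵥ u.ofLp)) / 2) ∂(P.prod P) := by
  have he : ∀ n, Measurable (e n) := fun n => (Lp.stronglyMeasurable (e n)).measurable
  have h1 : ∀ ω, ((‖charFun (lawMap P (∑ n ∈ Finset.range N,
      vecMul (ξ n ω) (e n))).toMeasure u‖ ^ 2 : ℝ) : ℂ) =
      ∫ q : Q × Q, Complex.exp ((∑ n ∈ Finset.range N,
        inner ℝ (ξ n ω) ((e n q.1 - e n q.2) • u) : ℝ) * Complex.I) ∂(P.prod P) := by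
    intro ω
    rw [normSq_charFun_lawMap]
    have h2 := coeFn_sum_vecMul (fun n => ξ n ω) e N
    refine integral_congr_ae ?_
    filter_upwards [Measure.quasiMeasurePreserving_fst.ae h2,
      Measure.quasiMeasurePreserving_snd.ae h2] with q hq1 hq2
    rw [hq1, hq2, ← Finset.sum_sub_distrib, sum_inner]
    congr 3
    refine Finset.sum_congr rfl fun n _ => ?_
    rw [← sub_smul, real_inner_smul_left, real_inner_smul_right]
  have h3 : Integrable (Function.uncurry fun (ω : Ω) (q : Q × Q) =>
      Complex.exp ((∑ n ∈ Finset.range N,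
        inner ℝ (ξ n ω) ((e n q.1 - e n q.2) • u) : ℝ) * Complex.I)) (Pr.prod (P.prod P)) := by
    refine Integrable.of_bound (C := 1) ?_ (Filter.Eventually.of_forall fun z => ?_)
    · refine AEMeasurable.aestronglyMeasurable ?_
      have h4 : AEMeasurable (fun z : Ω × Q × Q => ∑ n ∈ Finset.range N,
          (inner ℝ (ξ n z.1) ((e n z.2.1 - e n z.2.2) • u) : ℝ)) (Pr.prod (P.prod P)) := by
        refine Finset.aemeasurable_fun_sum _ fun n _ => ?_
        refine AEMeasurable.inner ?_ (Measurable.aemeasurable ?_)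
        · exact (hξ n).aemeasurable.comp_quasiMeasurePreserving
            Measure.quasiMeasurePreserving_fst
        · exact (((he n).comp (measurable_fst.comp measurable_snd)).sub
            ((he n).comp (measurable_snd.comp measurable_snd))).smul_const u
      exact Complex.measurable_exp.comp_aemeasurable
        ((Complex.measurable_ofReal.comp_aemeasurable h4).mul_const _)
    · rw [Function.uncurry, Complex.norm_exp_ofReal_mul_I]
  rw [← Complex.ofReal_inj, ← integral_complex_ofReal, ← integral_complex_ofReal]
  simp_rw [h1]
  rw [integral_integral_swap h3]
  refine integral_congr_ae (Filter.Eventually.of_forall fun q => ?_)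
  simp only
  rw [integral_exp_sum_inner hS hξ hind]
  simp_rw [dotProduct_mulVec_eq_smul]
  push_cast
  rfl

theorem lintegral_enorm_sq_charFun_sum_le (hS : ∀ n, (S n).PosSemidef)
    (hαS : ∀ n (v : EuclideanSpace ℝ (Fin d)), ‖v‖ = 1 →
      α n ^ 2 ≤ (S n *ᵥ v.ofLp) ⬝ᵥ v.ofLp)
    (hξ : ∀ n, HasLaw (ξ n) (multivariateGaussian 0 (S n)) Pr) (hind : iIndepFun ξ Pr)
    [MeasurableSpace.CountablyGenerated Q]
    (e : HilbertBasis ℕ ℝ (Lp ℝ 2 P)) (N : ℕ) (u : EuclideanSpace ℝ (Fin d)) :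
    ∫⁻ ω, ‖charFun (lawMap P (∑ n ∈ Finset.range N, vecMul (ξ n ω) (e n))).toMeasure u‖ₑ ^ 2 ∂Pr ≤
      ∫⁻ q, ENNReal.ofReal (Real.exp (-(partialKernel α e N q * ‖u‖ ^ 2 / 2))) ∂(P.prod P) := by
  have he : ∀ n, Measurable (e n) := fun n => (Lp.stronglyMeasurable (e n)).measurable
  have hm : AEMeasurable (fun ω => charFun (lawMap P (∑ n ∈ Finset.range N,
      vecMul (ξ n ω) (e n))).toMeasure u) Pr :=
    ((continuous_charFun_toMeasure u).comp (continuous_lawMap P)).measurable.comp_aemeasurable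
      (aemeasurable_sum_vecMul (fun n => (hξ n).aemeasurable) N)
  have h1 : ∀ ω, ‖charFun (lawMap P (∑ n ∈ Finset.range N,
      vecMul (ξ n ω) (e n))).toMeasure u‖ₑ ^ 2 = ENNReal.ofReal (‖charFun (lawMap P
        (∑ n ∈ Finset.range N, vecMul (ξ n ω) (e n))).toMeasure u‖ ^ 2) := fun ω => by
    rw [ENNReal.ofReal_pow (norm_nonneg _), ofReal_norm]
  have hb : ∀ n, α n ^ 2 * ‖u‖ ^ 2 ≤ (S n *ᵥ u.ofLp) ⬝ᵥ u.ofLp := fun n =>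
    le_dotProduct_mulVec (hαS n) u
  simp_rw [h1]
  rw [← ofReal_integral_eq_lintegral_ofReal, integral_normSq_charFun_sum hS hξ hind,
    ofReal_integral_eq_lintegral_ofReal]
  · refine lintegral_mono fun q => ENNReal.ofReal_le_ofReal (Real.exp_le_exp.2 ?_)
    rw [neg_div, neg_le_neg_iff, partialKernel, Finset.sum_mul]
    refine div_le_div_of_nonneg_right (Finset.sum_le_sum fun n _ => ?_) (by norm_num)
    rw [mul_right_comm, mul_comm]
    exact mul_le_mul_of_nonneg_left (hb n) (sq_nonneg _)
  · refine Integrable.of_bound (C := 1) (Measurable.aestronglyMeasurable ?_)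
      (Filter.Eventually.of_forall fun q => ?_)
    · exact ((Finset.measurable_fun_sum _ fun n _ => ((((he n).comp measurable_fst).sub
        ((he n).comp measurable_snd)).pow_const 2).mul_const _).neg.div_const 2).exp
    · rw [Real.norm_of_nonneg (Real.exp_pos _).le, Real.exp_le_one_iff, neg_div, neg_nonpos]
      refine div_nonneg (Finset.sum_nonneg fun n _ => mul_nonneg (sq_nonneg _) ?_) (by norm_num)
      exact (by positivity : (0 : ℝ) ≤ _).trans (hb n)
  · exact Filter.Eventually.of_forall fun q => (Real.exp_pos _).le
  · refine Integrable.of_bound (C := 1) (hm.norm.pow_const 2).aestronglyMeasurable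
      (Filter.Eventually.of_forall fun ω => ?_)
    rw [Real.norm_of_nonneg (by positivity)]
    exact pow_le_one₀ (norm_nonneg _) (norm_charFun_le_one u)
  · exact Filter.Eventually.of_forall fun ω => by positivity

variable [MeasurableSpace.CountablyGenerated Q]

/-- The left side passes to the limit by continuity and domination by 1, the right side by
decreasing monotone convergence. -/
theorem lintegral_enorm_sq_charFun_klVector_le (hS : ∀ n, (S n).PosSemidef)
    (hαS : ∀ n (v : EuclideanSpace ℝ (Fin d)), ‖v‖ = 1 →
      α n ^ 2 ≤ (S n *ᵥ v.ofLp) ⬝ᵥ v.ofLp)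
    (hξ : ∀ n, HasLaw (ξ n) (multivariateGaussian 0 (S n)) Pr) (hind : iIndepFun ξ Pr)
    (hfin : ∑' n, ∫⁻ ω, ‖ξ n ω‖ₑ ^ 2 ∂Pr < ∞) (u : EuclideanSpace ℝ (Fin d)) :
    ∫⁻ ω, ‖charFun (lawMap P (klVector ξ e ω)).toMeasure u‖ₑ ^ 2 ∂Pr ≤
      ∫⁻ q, ⨅ N, ENNReal.ofReal (Real.exp (-(partialKernel α e N q * ‖u‖ ^ 2 / 2)))
        ∂(P.prod P) := by
  have hξm : ∀ n, AEMeasurable (ξ n) Pr := fun n => (hξ n).aemeasurable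
  have hcont : Continuous fun X : Lp (EuclideanSpace ℝ (Fin d)) 2 P =>
      ‖charFun (lawMap P X).toMeasure u‖ₑ ^ 2 :=
    (ENNReal.continuous_pow 2).comp
      ((continuous_charFun_toMeasure u).comp (continuous_lawMap P)).enorm
  have hlim : Filter.Tendsto (fun N => ∫⁻ ω, ‖charFun (lawMap P
      (∑ n ∈ Finset.range N, vecMul (ξ n ω) (e n))).toMeasure u‖ₑ ^ 2 ∂Pr) Filter.atTop
      (nhds (∫⁻ ω, ‖charFun (lawMap P (klVector ξ e ω)).toMeasure u‖ₑ ^ 2 ∂Pr)) := by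
    refine tendsto_lintegral_of_dominated_convergence' (fun _ => 1) (fun N => ?_)
      (fun N => Filter.Eventually.of_forall fun ω => ?_) (by simp) ?_
    · exact hcont.measurable.comp_aemeasurable (aemeasurable_sum_vecMul hξm N)
    · refine pow_le_one₀ bot_le ?_
      rw [← enorm_norm, Real.enorm_of_nonneg (norm_nonneg _), ENNReal.ofReal_le_one]
      exact norm_charFun_le_one u
    · filter_upwards [ae_summable_vecMul (e := e) hξm hfin] with ω hω
      exact (hcont.tendsto _).comp (tendsto_sum_vecMul_klVector hω)
  have hanti : ∀ q : Q × Q, Antitone fun N =>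
      ENNReal.ofReal (Real.exp (-(partialKernel α e N q * ‖u‖ ^ 2 / 2))) := by
    intro q M N hMN
    have := monotone_partialKernel α e q hMN
    refine ENNReal.ofReal_le_ofReal (Real.exp_le_exp.2 ?_)
    simp only at this
    gcongr
  have hmeas : ∀ N, Measurable fun q : Q × Q =>
      ENNReal.ofReal (Real.exp (-(partialKernel α e N q * ‖u‖ ^ 2 / 2))) := fun N =>
    ((((measurable_partialKernel α e N).mul_const _).div_const 2).neg.exp).ennreal_ofReal
  rw [lintegral_iInf hmeas (fun M N hMN q => hanti q hMN)]
  · refine le_iInf fun N => le_of_tendsto hlim ?_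
    filter_upwards [Filter.eventually_ge_atTop N] with M hM
    exact (lintegral_enorm_sq_charFun_sum_le hS hαS hξ hind e M u).trans
      (lintegral_mono fun q => hanti q hM)
  -- Decreasing convergence needs one finite integral: at `N = 0` the sum is empty and the integrand
  -- is 1.
  · simp [partialKernel]

/-- Berman's condition for Karhunen-Loève series. -/
theorem lintegral_lintegral_charFun_klVector_lt_top (hd : 1 ≤ d) (hS : ∀ n, (S n).PosSemidef)
    (hαS : ∀ n (v : EuclideanSpace ℝ (Fin d)), ‖v‖ = 1 →
      α n ^ 2 ≤ (S n *ᵥ v.ofLp) ⬝ᵥ v.ofLp)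
    (hξ : ∀ n, HasLaw (ξ n) (multivariateGaussian 0 (S n)) Pr) (hind : iIndepFun ξ Pr)
    (hfin : ∑' n, ∫⁻ ω, ‖ξ n ω‖ₑ ^ 2 ∂Pr < ∞)
    (hint : ∫⁻ q, (alphaKernel α e q.1 q.2 ^ d)⁻¹ ∂(P.prod P) < ∞) :
    ∫⁻ X, ∫⁻ u, ‖charFun (lawMap P X).toMeasure u‖ₑ ^ 2 ∂volume ∂(Pr.map (klVector ξ e)) < ∞ := by
  have hm : AEMeasurable (klVector ξ e) Pr :=
    aemeasurable_klVector (fun n => (hξ n).aemeasurable) hfin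
  have := Measure.isProbabilityMeasure_map hm
  have hmeas : Measurable fun z : Lp (EuclideanSpace ℝ (Fin d)) 2 P × EuclideanSpace ℝ (Fin d) =>
      ‖charFun (lawMap P z.1).toMeasure z.2‖ₑ ^ 2 :=
    ((measurable_charFun_toMeasure.comp (measurable_snd.prodMk
      ((continuous_lawMap P).measurable.comp measurable_fst))).enorm).pow_const 2
  have hmeas' : Measurable fun z : EuclideanSpace ℝ (Fin d) × Q × Q =>
      ⨅ N, ENNReal.ofReal (Real.exp (-(partialKernel α e N z.2 * ‖z.1‖ ^ 2 / 2))) :=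
    .iInf fun N => ((((measurable_partialKernel α e N).comp measurable_snd).mul
      (measurable_fst.norm.pow_const 2)).div_const 2).neg.exp.ennreal_ofReal
  calc _ = ∫⁻ u, ∫⁻ X, ‖charFun (lawMap P X).toMeasure u‖ₑ ^ 2 ∂(Pr.map (klVector ξ e)) ∂volume :=
        lintegral_lintegral_swap hmeas.aemeasurable
    _ ≤ ∫⁻ u : EuclideanSpace ℝ (Fin d), ∫⁻ q, ⨅ N, ENNReal.ofReal (Real.exp
          (-(partialKernel α e N q * ‖u‖ ^ 2 / 2))) ∂(P.prod P) ∂volume := by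
        refine lintegral_mono fun u => ?_
        refine (lintegral_map' (f := fun X => ‖charFun (lawMap P X).toMeasure u‖ₑ ^ 2)
          (hmeas.comp measurable_prodMk_right).aemeasurable hm).trans_le ?_
        exact lintegral_enorm_sq_charFun_klVector_le hS hαS hξ hind hfin u
    _ = ∫⁻ q, ∫⁻ u : EuclideanSpace ℝ (Fin d), ⨅ N, ENNReal.ofReal (Real.exp
          (-(partialKernel α e N q * ‖u‖ ^ 2 / 2))) ∂volume ∂(P.prod P) :=
        lintegral_lintegral_swap hmeas'.aemeasurable
    _ ≤ ∫⁻ q, ENNReal.ofReal ((2 * Real.pi) ^ ((d : ℝ) / 2)) *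
          (alphaKernel α e q.1 q.2 ^ d)⁻¹ ∂(P.prod P) :=
        lintegral_mono fun q => lintegral_iInf_exp_le hd α e q
    _ < ∞ := by
        rw [lintegral_const_mul' _ _ ENNReal.ofReal_ne_top]
        exact ENNReal.mul_lt_top ENNReal.ofReal_lt_top hint

end Berman

end RandomMeasureLaw

/-! ### Assembly -/

theorem mainTheorem9
    {Q : Type*} [MeasurableSpace Q] [StandardBorelSpace Q]
    (P : Measure Q) [IsProbabilityMeasure P] [NullSingletonClass P]
    {Ω : Type*} [MeasurableSpace Ω] (Pr : Measure Ω) [IsProbabilityMeasure Pr]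
    (d : ℕ) (hd : 1 ≤ d)
    (e : HilbertBasis ℕ ℝ (Lp ℝ 2 P))
    (S : ℕ → Matrix (Fin d) (Fin d) ℝ) (hS : ∀ n, (S n).PosDef)
    (α β : ℕ → ℝ) (hα : ∀ n, 0 < α n ^ 2)
    (hαS : ∀ n (v : EuclideanSpace ℝ (Fin d)), ‖v‖ = 1 →
      α n ^ 2 ≤ (S n *ᵥ v.ofLp) ⬝ᵥ v.ofLp)
    (hSβ : ∀ n (v : EuclideanSpace ℝ (Fin d)), ‖v‖ = 1 →
      (S n *ᵥ v.ofLp) ⬝ᵥ v.ofLp ≤ β n ^ 2)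
    (hβ : Summable fun n => β n ^ 2)
    (ξ : ℕ → Ω → EuclideanSpace ℝ (Fin d))
    (hξ : ∀ n, HasLaw (ξ n) (multivariateGaussian 0 (S n)) Pr)
    (hind : iIndepFun ξ Pr)
    (hint : ∫⁻ q, (alphaKernel α e q.1 q.2 ^ d)⁻¹ ∂(P.prod P) < ∞) :
    (∀ᵐ ω ∂Pr, Summable fun n => vecMul (ξ n ω) (e n)) ∧
    IsSuperGRegular P ((Pr.map (klVector ξ e)).map (lawMap P)) ∧
    ∫⁻ X, ∫⁻ u, ‖charFun (lawMap P X).toMeasure u‖ₑ ^ 2 ∂volume ∂(Pr.map (klVector ξ e)) < ∞ ∧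
    ∀ᵐ X ∂(Pr.map (klVector ξ e)), ∃ ρ : EuclideanSpace ℝ (Fin d) → ℝ,
      (∀ x, 0 ≤ ρ x) ∧ MemLp ρ 2 volume ∧
      (lawMap P X).toMeasure = volume.withDensity fun x => ENNReal.ofReal (ρ x) := by
  have hS' : ∀ n, (S n).PosSemidef := fun n => (hS n).posSemidef
  have hξm : ∀ n, AEMeasurable (ξ n) Pr := fun n => (hξ n).aemeasurable
  have hfin := tsum_lintegral_enorm_sq_lt_top hS' hSβ hβ hξ
  have hm : AEMeasurable (klVector ξ e) Pr := aemeasurable_klVector hξm hfin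
  have hprob := Measure.isProbabilityMeasure_map hm
  have hlaw : Measurable (lawMap (H := EuclideanSpace ℝ (Fin d)) P) :=
    (continuous_lawMap P).measurable
  have hgauss := isNondegenerateGaussian_map_klVector (e := e) hS' hα hαS hSβ hβ hξ hind
  have hberman := lintegral_lintegral_charFun_klVector_lt_top (e := e) hd hS' hαS hξ hind hfin hint
  have hF := measurable_lintegral_charFun_sq (H := EuclideanSpace ℝ (Fin d)) volume
  have hae : ∀ᵐ X ∂(Pr.map (klVector ξ e)),
      ∫⁻ u, ‖charFun (lawMap P X).toMeasure u‖ₑ ^ 2 ∂volume < ∞ :=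
    ae_lt_top (hF.comp hlaw) hberman.ne
  refine ⟨ae_summable_vecMul hξm hfin, ⟨?_, ?_, fun B hB => ?_, ?_⟩, hberman, ?_⟩
  · exact Measure.isProbabilityMeasure_map hlaw.aemeasurable
  -- This inequality requires no measurability of the moment functional.
  · refine (lintegral_map_le _ (lawMap P)).trans_lt ?_
    simp_rw [momentSq_lawMap]
    rw [lintegral_map' (f := fun X => ‖X‖ₑ ^ 2) (by fun_prop) hm,
      lintegral_enorm_sq_klVector hξm hfin]
    exact hfin
  · rw [Measure.map_apply hlaw hB.1]
    exact hB.2.2 _ hgauss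
  -- Finite Fourier energy is a Borel event, so it transfers through `lawMap`; regularity is deduced
  -- from it afterwards.
  · have h1 : ∀ᵐ μ ∂((Pr.map (klVector ξ e)).map (lawMap P)),
        ∫⁻ u, ‖charFun μ.toMeasure u‖ₑ ^ 2 ∂volume < ∞ :=
      (ae_map_iff hlaw.aemeasurable (measurableSet_lt hF measurable_const)).2 hae
    filter_upwards [h1] with μ hμ
    obtain ⟨ρ, -, -, hρ⟩ := exists_density_of_charFun_sq_integrable μ.toMeasure hμ
    refine P2.isRegular_of_absolutelyContinuous ?_
    rw [hρ]
    exact withDensity_absolutelyContinuous _ _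
  · filter_upwards [hae] with X hX
    exact exists_density_of_charFun_sq_integrable _ hX
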